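/- \textbf{Corollary (group of geometric dimension $n$).} Let $n\ge 0$ and let $\Gamma$ be a group of geometric dimension $n$, i.e. $n$ is the smallest dimension of a simplicial Eilenberg--MacLane space of $\Gamma$. Suppose that $\Gamma$ is of type $\mathrm{F}_n$, witnessed by an Eilenberg--MacLane space of $\Gamma$ with universal cover $X$; that is, $X$ is a contractible simplicial complex with a free action of $\Gamma$ by simplicial automorphisms and with only finitely many $\Gamma$-orbits of simplices of dimension at most $n$. Let $S$ be a finite generating set of $\Gamma$, and let $\pi$ be a representation of $\Gamma$ by bounded invertible linear operators on a real or complex Banach space $E$. If the group cohomology $H^n(\Gamma,\pi)$ with coefficients in the $\Gamma$-module $(E,\pi)$ vanishes, then there exists $\varepsilon>0$, depending only on $\Gamma$, $X$, $S$ and $\pi$, such that $H^n(\Gamma,\rho)=0$ for every $\varepsilon$-deformation $\rho$ of $\pi$, i.e. for every representation $\rho$ of $\Gamma$ by bounded invertible linear operators on $E$ with $\sup_{s\in S}\|\pi_s-\rho_s\|_{B(E)}\le\varepsilon$. -/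

import Mathlib

universe u v w

namespace BanachCohomology

/-- The underlying set of the geometric realization of an abstract simplicial complex:
barycentric coordinates that are nonnegative, vanish outside some simplex, and sum to `1`. -/
def Realization {V : Type v} (X : AbstractSimplicialComplex V) : Type v :=
  {x : V → ℝ // (∀ a, 0 ≤ x a) ∧ ∃ σ ∈ X.faces, (∀ a, a ∉ σ → x a = 0) ∧ ∑ a ∈ σ, x a = 1}

/-- The closed simplex of the realization spanned by a finite set `σ` of vertices. -/
def ClosedSimplex {V : Type v} (X : AbstractSimplicialComplex V) (σ : Finset V) : Type v :=
  {x : Realization X // ∀ a, a ∉ σ → x.1 a = 0}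

/-- A closed simplex carries its Euclidean topology, given by the barycentric coordinates. -/
instance {V : Type v} (X : AbstractSimplicialComplex V) (σ : Finset V) :
    TopologicalSpace (ClosedSimplex X σ) :=
  TopologicalSpace.induced (fun x => x.1.1) inferInstance

/-- The weak (coherent) topology: a set is open if and only if its trace on each closed simplex
is open in that simplex. -/
instance {V : Type v} (X : AbstractSimplicialComplex V) : TopologicalSpace (Realization X) :=
  ⨆ σ : X.faces, TopologicalSpace.coinduced
    (fun x : ClosedSimplex X (σ : Finset V) => x.1) inferInstance

/-- The translate of a finite set of vertices by a group element. -/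
def translate {Γ : Type u} [Group Γ] {V : Type v} [MulAction Γ V] (g : Γ) (σ : Finset V) :
    Finset V :=
  σ.map (MulAction.toPerm g).toEmbedding

/-- `X` is a contractible simplicial complex on which `Γ` acts freely by simplicial automorphisms,
i.e. the universal cover of a simplicial Eilenberg-MacLane space `X / Γ` of `Γ`.
(The action on the realization is free if and only if no nontrivial element maps a simplex
to itself.) -/
structure IsEilenbergMacLane (Γ : Type u) [Group Γ] {V : Type v} [MulAction Γ V]
    (X : AbstractSimplicialComplex V) : Prop where
  translate_mem : ∀ (g : Γ), ∀ σ ∈ X.faces, translate g σ ∈ X.faces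
  free : ∀ (g : Γ), ∀ σ ∈ X.faces, translate g σ = σ → g = 1
  contractible : ContractibleSpace (Realization X)

/-- Every simplex of `X` has dimension at most `d`. -/
def DimLE {V : Type v} (X : AbstractSimplicialComplex V) (d : ℕ) : Prop :=
  ∀ σ ∈ X.faces, σ.card ≤ d + 1

/-- The quotient of `X` by `Γ` has a finite `n`-skeleton: up to translation there are only finitely
many simplices of dimension at most `n`. -/
def HasFiniteSkeletonMod (Γ : Type u) [Group Γ] {V : Type v} [MulAction Γ V]
    (X : AbstractSimplicialComplex V) (n : ℕ) : Prop :=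
  ∃ T : Set (Finset V), T.Finite ∧
    ∀ σ ∈ X.faces, σ.card ≤ n + 1 → ∃ τ ∈ T, ∃ g : Γ, translate g τ = σ

/-- The geometric dimension of `Γ` is `n`: the least dimension of an Eilenberg-MacLane space
of `Γ` is `n`. -/
def HasGeometricDimension (Γ : Type u) [Group Γ] (n : ℕ) : Prop :=
  IsLeast {d : ℕ | ∃ (V : Type u) (_ : MulAction Γ V) (X : AbstractSimplicialComplex V),
    IsEilenbergMacLane Γ X ∧ DimLE X d} n

/-- The group cohomology `H^n(Γ, π)` with coefficients in the `Γ`-module `(E, π)`, for a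
representation `π` of `Γ` by bounded operators on `E`. -/
noncomputable def cohomology {𝕜 Γ E : Type u} [RCLike 𝕜] [Group Γ] [NormedAddCommGroup E]
    [NormedSpace 𝕜 E] (n : ℕ) (π : Γ →* (E →L[𝕜] E)) : ModuleCat 𝕜 :=
  groupCohomology
    (Rep.of ((ContinuousLinearMap.toLinearMapRingHom (R₁ := 𝕜) (M₁ := E)).toMonoidHom.comp π)) n

/-- `ρ` is an `ε`-deformation of `π` with respect to the generating set `S`. -/
def IsDeformation {𝕜 : Type u} {Γ : Type v} {E : Type w} [RCLike 𝕜] [Group Γ]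
    [NormedAddCommGroup E] [NormedSpace 𝕜 E]
    (S : Set Γ) (ε : ℝ) (π ρ : Γ →* (E →L[𝕜] E)) : Prop :=
  ∀ s ∈ S, ‖π s - ρ s‖ ≤ ε

end BanachCohomology

open CategoryTheory Filter Topology

namespace BanachCohomology

/-! Ordered chains on lists of vertices lying in a common simplex of `X` resolve the trivial module
by free permutation modules. After choosing orbit representatives, equivariant cochains of degree at
most `n` form a finite power of `E`, and the coboundary into degree `n` is a bounded operator
depending continuously on `ρ` (`tendsto_pullback`). The obstacle is that the space of cocycles moves
with `ρ`, while degree `n + 1`, where the cocycle condition lives, may have infinitely many orbits.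

The geometric dimension removes it. On the ordered chains of an `n`-dimensional Eilenberg-MacLane
space, antisymmetrization is an endomorphism over the identity (`altMap`); it vanishes in degree `n
+ 1`, where every list has a repetition. Comparing resolutions, the identity on the chains of `X` is
homotopic to a map vanishing in degree `n + 1`. The homotopy gives `h` with `∂ h ∂ = ∂`, and `e = 1
- ∂ h` is an idempotent in degree `n` whose fixed cochains are exactly the cocycles
(`exists_projector`). Neither `e` nor the differential `d` depends on the coefficients. Hence
`H^n(Γ, ρ) = 0` if and only if `(b, c) ↦ d^* b + (1 - e^*) c` is surjective
(`testOperator_surjective_iff`). This operator acts between fixed Banach spaces and is continuous in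
`ρ`, and surjectivity is an open condition (`eventually_surjective`).

Exactness of the ordered chains (`acyclic_faceLists`) is deduced directly from contractibility of
the realization. Acyclic carriers replace a cycle by a fine cycle of points of the realization; the
contraction fills it by small chains; sending each point to a vertex of maximal coordinate brings
the filling back to `X`, up to a homotopy that is again carried by simplices. -/

/-- Ordered chains: formal combinations of lists of vertices. The empty list has degree `-1`. -/
abbrev Chains (R : Type u) [CommRing R] (V : Type v) := List V →₀ R

/-! ### Augmented ordered chains: cones, prisms and acyclic carriers. -/

namespace Chains

section Basic

variable {R : Type u} [CommRing R] {V : Type v} {W : Type w}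

/-- Prepend a vertex to every list of a chain. -/
noncomputable def cons (a : V) : Chains R V →ₗ[R] Chains R V :=
  Finsupp.lmapDomain R R (List.cons a)

@[simp] lemma cons_single (a : V) (l : List V) (r : R) :
    cons a (Finsupp.single l r) = Finsupp.single (a :: l) r := by
  simp [cons]

/-- The boundary of a list, as an alternating sum of its faces. -/
noncomputable def boundaryList (R : Type u) [CommRing R] {V : Type v} : List V → Chains R V
  | [] => 0
  | a :: l => Finsupp.single l 1 - cons a (boundaryList R l)

/-- The boundary operator of the augmented complex of ordered chains. -/
noncomputable def boundary : Chains R V →ₗ[R] Chains R V :=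
  Finsupp.linearCombination R (boundaryList R)

/-- Linear maps out of chains agree if they agree on lists. -/
lemma hom_ext {M : Type*} [AddCommGroup M] [Module R M] {f g : Chains R V →ₗ[R] M}
    (h : ∀ l, f (Finsupp.single l 1) = g (Finsupp.single l 1)) : f = g :=
  Finsupp.lhom_ext' fun l => LinearMap.ext_ring (h l)

lemma boundary_single (l : List V) :
    boundary (Finsupp.single l (1 : R)) = boundaryList R l := by
  simp [boundary]

@[simp] lemma boundary_nil : boundary (Finsupp.single ([] : List V) (1 : R)) = 0 := by
  simp [boundary, boundaryList]

@[simp] lemma boundary_cons (a : V) (c : Chains R V) :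
    boundary (cons a c) = c - cons a (boundary c) := by
  have : boundary ∘ₗ cons a = LinearMap.id - (cons a (R := R)) ∘ₗ boundary := by
    refine hom_ext fun l => ?_
    simp [boundary_single, boundaryList]
  simpa using LinearMap.congr_fun this c

lemma single_cons (a : V) (l : List V) :
    (Finsupp.single (a :: l) (1 : R)) = cons a (Finsupp.single l 1) := by simp

@[simp] lemma boundary_boundary (c : Chains R V) : boundary (boundary c) = 0 := by
  have : boundary ∘ₗ boundary (R := R) (V := V) = 0 := by
    refine hom_ext fun l => ?_
    induction l with
    | nil => simp
    | cons a l ih =>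
      simp only [LinearMap.comp_apply, LinearMap.zero_apply] at ih ⊢
      rw [single_cons, boundary_cons, map_sub, boundary_cons, ih]
      simp
  simpa using LinearMap.congr_fun this c

/-- A linear map sends chains supported in `K` to `A` if it does so for the lists in `K`. -/
lemma map_mem_of_supported {M : Type*} [AddCommGroup M] [Module R M] {K : Set (List V)}
    (T : Chains R V →ₗ[R] M) (A : Submodule R M) (h : ∀ l ∈ K, T (Finsupp.single l 1) ∈ A)
    {c : Chains R V} (hc : c ∈ Finsupp.supported R R K) : T c ∈ A := by
  rw [Finsupp.supported_eq_span_single] at hc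
  have : Submodule.span R ((fun i => Finsupp.single i (1 : R)) '' K) ≤ A.comap T := by
    rw [Submodule.span_le]
    rintro _ ⟨l, hl, rfl⟩
    exact h l hl
  exact this hc

lemma eq_of_supported {M : Type*} [AddCommGroup M] [Module R M] {K : Set (List V)}
    {T T' : Chains R V →ₗ[R] M} (h : ∀ l ∈ K, T (Finsupp.single l 1) = T' (Finsupp.single l 1))
    {c : Chains R V} (hc : c ∈ Finsupp.supported R R K) : T c = T' c := by
  have := map_mem_of_supported (T - T') ⊥ (fun l hl => by simp [h l hl]) hc
  simpa [sub_eq_zero] using this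

lemma single_mem {K : Set (List V)} {l : List V} (hl : l ∈ K) (r : R) :
    Finsupp.single l r ∈ Finsupp.supported R R K :=
  Finsupp.single_mem_supported R r hl

lemma supported_mono {K K' : Set (List V)} (h : K ⊆ K') {c : Chains R V}
    (hc : c ∈ Finsupp.supported R R K) : c ∈ Finsupp.supported R R K' :=
  Finsupp.supported_mono h hc

lemma cons_mem {K K' : Set (List V)} {a : V} (h : ∀ l ∈ K, a :: l ∈ K') {c : Chains R V}
    (hc : c ∈ Finsupp.supported R R K) : cons a c ∈ Finsupp.supported R R K' :=
  map_mem_of_supported _ _ (fun l hl => by simpa using single_mem (h l hl) 1) hc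

lemma boundaryList_mem (l : List V) :
    boundaryList R l ∈ Finsupp.supported R R {m | m.Sublist l ∧ m.length + 1 = l.length} := by
  induction l with
  | nil => simp [boundaryList]
  | cons a l ih =>
    have h : ∀ m ∈ {m | m.Sublist l ∧ m.length + 1 = l.length},
        a :: m ∈ {m | m.Sublist (a :: l) ∧ m.length + 1 = (a :: l).length} :=
      fun m hm => ⟨hm.1.cons_cons a, by simp [hm.2]⟩
    have h' : l ∈ {m | m.Sublist (a :: l) ∧ m.length + 1 = (a :: l).length} :=
      ⟨List.sublist_cons_self a l, rfl⟩
    exact Submodule.sub_mem _ (single_mem h' 1) (cons_mem h ih)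

lemma boundary_mem {K : Set (List V)} (hK : ∀ l ∈ K, ∀ m, m.Sublist l → m ∈ K)
    {c : Chains R V} (hc : c ∈ Finsupp.supported R R K) :
    boundary c ∈ Finsupp.supported R R K :=
  map_mem_of_supported _ _ (fun l hl => by
    rw [boundary_single]
    exact supported_mono (fun m hm => hK l hl m hm.1) (boundaryList_mem l)) hc

/-- The map on chains induced by a map of vertices. -/
noncomputable def map (f : V → W) : Chains R V →ₗ[R] Chains R W :=
  Finsupp.lmapDomain R R (List.map f)

@[simp] lemma map_single (f : V → W) (l : List V) (r : R) :
    map f (Finsupp.single l r) = Finsupp.single (l.map f) r := by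
  simp [map]

@[simp] lemma map_cons (f : V → W) (a : V) (c : Chains R V) :
    map f (cons a c) = cons (f a) (map f c) := by
  have : map f ∘ₗ cons a = (cons (f a) (R := R)) ∘ₗ map f := hom_ext fun l => by simp
  simpa using LinearMap.congr_fun this c

@[simp] lemma boundary_map (f : V → W) (c : Chains R V) :
    boundary (map f c) = map f (boundary c) := by
  have : boundary ∘ₗ map f = (map f (R := R)) ∘ₗ boundary := by
    refine hom_ext fun l => ?_
    induction l with
    | nil => simp
    | cons a l ih =>
      simp only [LinearMap.comp_apply] at ih ⊢
      rw [single_cons, map_cons, boundary_cons, boundary_cons, map_sub, map_cons, ih]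
  simpa using LinearMap.congr_fun this c

lemma map_mem {K : Set (List V)} {L : Set (List W)} {f : V → W} (h : ∀ l ∈ K, l.map f ∈ L)
    {c : Chains R V} (hc : c ∈ Finsupp.supported R R K) :
    map f c ∈ Finsupp.supported R R L :=
  map_mem_of_supported _ _ (fun l hl => by simpa using single_mem (h l hl) 1) hc

lemma map_map {U : Type*} (f : V → W) (g : W → U) (c : Chains R V) :
    map g (map f c) = map (g ∘ f) c := by
  have : map g ∘ₗ map f = (map (g ∘ f) : Chains R V →ₗ[R] _) := hom_ext fun l => by simp
  simpa using LinearMap.congr_fun this c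

/-- The prism of a list between its images under two vertex maps. -/
noncomputable def prismList (R : Type u) [CommRing R] {V : Type v} {W : Type w} (f g : V → W) :
    List V → Chains R W
  | [] => 0
  | a :: l => cons (f a) (Finsupp.single (g a :: l.map g) 1) - cons (f a) (prismList R f g l)

/-- The prism operator between two vertex maps. -/
noncomputable def prism (f g : V → W) : Chains R V →ₗ[R] Chains R W :=
  Finsupp.linearCombination R (prismList R f g)

lemma prism_cons (f g : V → W) (a : V) (c : Chains R V) :
    prism f g (cons a c) = cons (f a) (cons (g a) (map g c)) - cons (f a) (prism f g c) := by
  have : prism f g ∘ₗ cons a =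
      cons (f a) ∘ₗ cons (g a) ∘ₗ map g - (cons (f a) (R := R)) ∘ₗ prism f g := by
    refine hom_ext fun l => ?_
    simp [prism, prismList]
  simpa using LinearMap.congr_fun this c

lemma boundary_prism (f g : V → W) (c : Chains R V) :
    boundary (prism f g c) + prism f g (boundary c) = map g c - map f c := by
  have : boundary ∘ₗ prism f g + prism f g ∘ₗ boundary =
      (map g : Chains R V →ₗ[R] Chains R W) - map f := by
    refine hom_ext fun l => ?_
    induction l with
    | nil => simp [prism, prismList]
    | cons a l ih =>
      simp only [LinearMap.comp_apply, LinearMap.add_apply, LinearMap.sub_apply] at ih ⊢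
      simp only [single_cons, prism_cons, boundary_cons, map_sub, map_cons, boundary_map]
      rw [eq_sub_of_add_eq ih]
      simp only [map_sub]
      abel
  simpa using LinearMap.congr_fun this c

lemma prismList_mem (f g : V → W) (l : List V) :
    prismList R f g l ∈ Finsupp.supported R R {m | m ⊆ l.map f ++ l.map g} := by
  induction l with
  | nil => simp [prismList]
  | cons a l ih =>
    refine Submodule.sub_mem _ ?_ ?_
    · rw [cons_single]
      refine single_mem ?_ 1
      intro x
      simp only [List.mem_cons, List.map_cons, List.mem_append]
      tauto
    · refine cons_mem ?_ ih
      intro m hm x hx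
      have := @hm x
      simp only [List.mem_cons, List.map_cons, List.mem_append] at hx this ⊢
      tauto

/-- A family of lists is acyclic if every cycle supported in it is a boundary in it. -/
def Acyclic (R : Type u) [CommRing R] {V : Type v} (K : Set (List V)) : Prop :=
  ∀ z ∈ Finsupp.supported R R K, boundary z = 0 →
    ∃ w ∈ Finsupp.supported R R K, boundary w = z

/-- Prepending `a` is a contracting homotopy, since `∂ (a z) = z - a (∂ z)`. -/
lemma acyclic_of_cone {K : Set (List V)} (a : V) (h : ∀ l ∈ K, a :: l ∈ K) : Acyclic R K :=
  fun z hz hz0 => ⟨cons a z, cons_mem h hz, by simp [hz0]⟩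

/-- Vertex maps joined by a chain of contiguous maps carry cycles to homologous cycles. -/
lemma exists_boundary_eq_sub {K : Set (List V)} {L : Set (List W)}
    (hL : ∀ l ∈ L, ∀ m, m ⊆ l → m ∈ L) (h : ℕ → V → W) (N : ℕ)
    (hh : ∀ j < N, ∀ l ∈ K, l.map (h j) ++ l.map (h (j + 1)) ∈ L)
    {z : Chains R V} (hz : z ∈ Finsupp.supported R R K) (hz0 : boundary z = 0) :
    ∃ w ∈ Finsupp.supported R R L, boundary w = map (h N) z - map (h 0) z := by
  induction N with
  | zero => exact ⟨0, Submodule.zero_mem _, by simp⟩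
  | succ N ih =>
    obtain ⟨w, hw, hw'⟩ := ih fun j hj => hh j (by omega)
    refine ⟨w + prism (h N) (h (N + 1)) z, Submodule.add_mem _ hw ?_, ?_⟩
    · refine map_mem_of_supported _ _ (fun l hl => ?_) hz
      simp only [prism, Finsupp.linearCombination_single, one_smul]
      exact supported_mono (fun m hm => hL _ (hh N (by omega) l hl) m hm) (prismList_mem _ _ l)
    · have := boundary_prism (h N) (h (N + 1)) z
      rw [hz0, map_zero, add_zero] at this
      rw [map_add, hw', this]
      abel

/-- Acyclic carriers: solve `∂ u = θ + c u ∂` on the lists of bounded length in `K`, with `u l`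
in a prescribed submodule `A l`. -/
lemma exists_carried {K : Set (List V)} (hK : ∀ l ∈ K, ∀ m, m.Sublist l → m ∈ K)
    (A : List V → Set (List W)) (hA : ∀ l m, m.Sublist l → A m ⊆ A l)
    (hac : ∀ l ∈ K, l ≠ [] → Acyclic R (A l))
    (θ : Chains R V →ₗ[R] Chains R W) (c : R)
    (hθ : ∀ l ∈ K, θ (Finsupp.single l 1) ∈ Finsupp.supported R R (A l))
    (hθc : ∀ l ∈ K, boundary (θ (Finsupp.single l 1)) = - (c • θ (boundary (Finsupp.single l 1))))
    (b : Chains R W) (hbA : b ∈ Finsupp.supported R R (A []))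
    (hb : boundary b = θ (Finsupp.single [] 1)) (N : ℕ) :
    ∃ u : Chains R V →ₗ[R] Chains R W, u (Finsupp.single [] 1) = b ∧
      ∀ l ∈ K, l.length ≤ N →
        u (Finsupp.single l 1) ∈ Finsupp.supported R R (A l) ∧
        boundary (u (Finsupp.single l 1)) =
          θ (Finsupp.single l 1) + c • u (boundary (Finsupp.single l 1)) := by
  classical
  induction N with
  | zero =>
    -- Only the value on the empty list matters at this stage; the others are overwritten later.
    refine ⟨Finsupp.linearCombination R fun _ => b, by simp, fun l _ hl0 => ?_⟩
    obtain rfl : l = [] := List.length_eq_zero_iff.1 (by omega)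
    simp [hbA, hb]
  | succ N ih =>
    obtain ⟨u, hu0, hu⟩ := ih
    have key : ∀ l ∈ K, l.length = N + 1 → ∃ w ∈ Finsupp.supported R R (A l),
        boundary w = θ (Finsupp.single l 1) + c • u (boundary (Finsupp.single l 1)) := by
      intro l hl hlen
      have hbd : boundary (Finsupp.single l (1 : R)) ∈
          Finsupp.supported R R {m | m.Sublist l ∧ m.length + 1 = l.length} := by
        rw [boundary_single]; exact boundaryList_mem l
      refine hac l hl (by rintro rfl; simp at hlen) _ (Submodule.add_mem _ (hθ l hl)
        (Submodule.smul_mem _ _ ?_)) ?_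
      · refine map_mem_of_supported u _ (fun m hm => ?_) hbd
        exact supported_mono (hA l m hm.1) (hu m (hK l hl m hm.1) (by have := hm.2; omega)).1
      -- The right-hand side is a cycle: the equation already known on the faces gives `∂ u ∂ = θ
      -- ∂`, because the term `c u ∂ ∂` vanishes.
      · have h1 : (boundary ∘ₗ u) (boundary (Finsupp.single l (1 : R))) =
            (θ + c • (u ∘ₗ boundary)) (boundary (Finsupp.single l (1 : R))) := by
          refine eq_of_supported (fun m hm => ?_) hbd
          simpa using (hu m (hK l hl m hm.1) (by have := hm.2; omega)).2
        have h2 : boundary (u (boundary (Finsupp.single l (1 : R)))) =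
            θ (boundary (Finsupp.single l (1 : R))) := by simpa using h1
        rw [map_add, map_smul, h2, hθc l hl]
        simp
    choose! w hw hw' using key
    -- Changing `u` only in length `N + 1` leaves it untouched on boundaries of lists of length at
    -- most `N + 1`.
    let u' : Chains R V →ₗ[R] Chains R W := Finsupp.linearCombination R fun l =>
      if l.length = N + 1 then w l else u (Finsupp.single l 1)
    have hu' : ∀ l : List V, l.length ≠ N + 1 →
        u' (Finsupp.single l 1) = u (Finsupp.single l 1) := by
      intro l hl
      simp [u', hl]
    have hbd : ∀ l : List V, l.length ≤ N + 1 →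
        u' (boundary (Finsupp.single l 1)) = u (boundary (Finsupp.single l 1)) := by
      intro l hl
      rw [boundary_single]
      refine eq_of_supported (fun m hm => hu' m ?_) (boundaryList_mem l)
      have := hm.2
      omega
    refine ⟨u', by rw [hu' [] (by simp), hu0], fun l hl hlen => ?_⟩
    rw [hbd l hlen]
    by_cases h : l.length = N + 1
    · have : u' (Finsupp.single l 1) = w l := by simp [u', h]
      rw [this]
      exact ⟨hw l hl h, hw' l hl h⟩
    · rw [hu' l h]
      exact hu l hl (by omega)

end Basic

end Chains

/-! ### Vietoris-Rips complexes of bounded convex sets. -/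

namespace Chains

/-- Lists of points of `C` that are pairwise at distance less than `ε`. -/
def rips {E : Type*} [PseudoMetricSpace E] (C : Set E) (ε : ℝ) : Set (List E) :=
  {l | (∀ x ∈ l, x ∈ C) ∧ ∀ x ∈ l, ∀ y ∈ l, dist x y < ε}

/-- Only finitely many distances occur, so the strict bound leaves a slack `ε - d`, which pays for
the steps of a discretized contraction. -/
lemma exists_lt_of_mem_rips {E : Type*} [PseudoMetricSpace E] {C : Set E} {ε : ℝ}
    {F : Set (List E)} (hF : F.Finite) (h : F ⊆ rips C ε) :
    ∃ d < ε, ∀ l ∈ F, ∀ x ∈ l, ∀ y ∈ l, dist x y ≤ d := by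
  have h1 : ∀ᶠ d in 𝓝[<] ε, ∀ l ∈ F, ∀ x ∈ l, ∀ y ∈ l, dist x y ≤ d := by
    refine (eventually_all_finite hF).2 fun l hl => ?_
    refine (eventually_all_finite (List.finite_toSet l)).2 fun x hx => ?_
    refine (eventually_all_finite (List.finite_toSet l)).2 fun y hy => ?_
    filter_upwards [Ico_mem_nhdsLT ((h hl).2 x hx y hy)] with d hd using hd.1
  obtain ⟨d, hd, hd'⟩ := (h1.and self_mem_nhdsWithin).exists
  exact ⟨d, hd', hd⟩

/-- The Vietoris-Rips complex of a bounded nonempty convex set is acyclic. -/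
lemma acyclic_rips {R : Type u} [CommRing R] {E : Type*} [NormedAddCommGroup E] [NormedSpace ℝ E]
    {C : Set E} (hC : Convex ℝ C) (hb : Bornology.IsBounded C) {c : E} (hc : c ∈ C) {ε : ℝ}
    (hε : 0 < ε) : Acyclic R (rips C ε) := by
  intro z hz hz0
  obtain ⟨d, hd, hzd⟩ := exists_lt_of_mem_rips z.support.finite_toSet hz
  obtain ⟨D, hD0, hD⟩ := hb.subset_closedBall_lt 0 c
  -- The contraction to `c` is cut into `N` steps, each moving points by at most `D / N < ε - d`;
  -- two consecutive stages of a list then remain within `ε`.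
  obtain ⟨N, hN⟩ := exists_nat_gt (D / (ε - d))
  have hNpos : (0 : ℝ) < N := lt_trans (div_pos hD0 (by linarith)) hN
  have hDN : d + D / N < ε := by
    rw [div_lt_iff₀ (by linarith)] at hN
    have : D / N < ε - d := by rw [div_lt_iff₀ hNpos]; linarith
    linarith
  let h : ℕ → E → E := fun j x => AffineMap.lineMap x c ((j : ℝ) / N)
  have hmem : ∀ j ≤ N, ∀ x ∈ C, h j x ∈ C := fun j hj x hx =>
    hC.lineMap_mem hx hc ⟨by positivity, by
      rw [div_le_one hNpos]; exact_mod_cast hj⟩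
  have hsame : ∀ j ≤ N, ∀ x y, dist x y ≤ d → dist (h j x) (h j y) ≤ d := by
    intro j hj x y hxy
    have h0 : (0 : ℝ) ≤ j / N := by positivity
    have h1 : (j : ℝ) / N ≤ 1 := by rw [div_le_one hNpos]; exact_mod_cast hj
    have : h j x - h j y = (1 - (j : ℝ) / N) • (x - y) := by
      simp only [h, AffineMap.lineMap_apply_module]
      module
    rw [dist_eq_norm, this, norm_smul, Real.norm_of_nonneg (by linarith), ← dist_eq_norm x y]
    nlinarith [dist_nonneg (x := x) (y := y)]
  have hstep : ∀ j x, x ∈ C → dist (h j x) (h (j + 1) x) ≤ D / N := by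
    intro j x hx
    have h2 : dist x c ≤ D := hD hx
    simp only [h]
    rw [dist_lineMap_lineMap, Real.dist_eq]
    have : (j : ℝ) / N - ((j + 1 : ℕ) : ℝ) / N = - (1 / N) := by push_cast; ring
    rw [this, abs_neg, abs_of_pos (by positivity), div_mul_eq_mul_div, one_mul]
    gcongr
  obtain ⟨w, hw, hw'⟩ := exists_boundary_eq_sub (R := R) (K := (z.support : Set (List E)))
    (L := rips C ε) (fun l hl m hm => ⟨fun x hx => hl.1 x (hm hx),
      fun x hx y hy => hl.2 x (hm hx) y (hm hy)⟩) h N (fun j hj l hl => by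
        refine ⟨fun x hx => ?_, fun x hx y hy => ?_⟩
        · simp only [List.mem_append, List.mem_map] at hx
          rcases hx with ⟨x, hx, rfl⟩ | ⟨x, hx, rfl⟩
          · exact hmem j hj.le x ((hz hl).1 x hx)
          · exact hmem (j + 1) hj x ((hz hl).1 x hx)
        · have hDN' : 0 ≤ D / N := by positivity
          simp only [List.mem_append, List.mem_map] at hx hy
          rcases hx with ⟨x, hx, rfl⟩ | ⟨x, hx, rfl⟩ <;> rcases hy with ⟨y, hy, rfl⟩ | ⟨y, hy, rfl⟩
          · linarith [hsame j hj.le x y (hzd l hl x hx y hy)]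
          · linarith [dist_triangle (h j x) (h j y) (h (j + 1) y),
              hsame j hj.le x y (hzd l hl x hx y hy), hstep j y ((hz hl).1 y hy)]
          · linarith [dist_triangle (h (j + 1) x) (h j x) (h j y), dist_comm (h j x) (h (j + 1) x),
              hsame j hj.le x y (hzd l hl x hx y hy), hstep j x ((hz hl).1 x hx)]
          · linarith [hsame (j + 1) hj x y (hzd l hl x hx y hy)])
      (Finsupp.mem_supported_support R z) hz0
  have h0 : map (h 0) z = z := by
    have : h 0 = id := by ext x; simp [h]
    have h1 : (map id : Chains R E →ₗ[R] _) = LinearMap.id := hom_ext fun l => by simp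
    rw [this, h1, LinearMap.id_apply]
  have hN' : ∀ x, h N x = c := fun x => by simp [h, div_self hNpos.ne']
  -- After the last step the cycle lives on the single point `c`, where the cone fills it.
  have hmapN : map (h N) z ∈ Finsupp.supported R R {l | ∀ x ∈ l, x = c} :=
    map_mem (K := Set.univ) (fun l _ x hx => by
      obtain ⟨y, _, rfl⟩ := List.mem_map.1 hx
      exact hN' y) (by simp)
  obtain ⟨w', hw1, hw2⟩ := acyclic_of_cone (K := {l : List E | ∀ x ∈ l, x = c}) c
    (fun l hl x hx => by
      rcases List.mem_cons.1 hx with rfl | hx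
      exacts [rfl, hl x hx]) _ hmapN (by rw [boundary_map, hz0, map_zero])
  have hsub : {l : List E | ∀ x ∈ l, x = c} ⊆ rips C ε := fun l hl =>
    ⟨fun x hx => by rw [hl x hx]; exact hc,
      fun x hx y hy => by rw [hl x hx, hl y hy, dist_self]; exact hε⟩
  refine ⟨w' - w, Submodule.sub_mem _ (supported_mono hsub hw1) hw, ?_⟩
  · rw [map_sub, hw2, hw', h0]; abel

end Chains

/-! ### The realization: closed simplices, the open cover by peak sets, and fine lists. -/

section Geometry

variable {V : Type v} {X : AbstractSimplicialComplex V}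

/-- The lists whose entries lie in a common face. -/
def faceLists (X : AbstractSimplicialComplex V) : Set (List V) :=
  {l | ∃ σ ∈ X.faces, ∀ a ∈ l, a ∈ σ}

lemma faceLists_of_subset {l m : List V} (hl : l ∈ faceLists X) (h : m ⊆ l) : m ∈ faceLists X := by
  obtain ⟨σ, hσ, hl⟩ := hl
  exact ⟨σ, hσ, fun a ha => hl a (h ha)⟩

lemma toFinset_mem_faces [DecidableEq V] {l : List V} (hl : l ∈ faceLists X) (h : l ≠ []) :
    l.toFinset ∈ X.faces := by
  obtain ⟨σ, hσ, hl⟩ := hl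
  refine (X.isRelLowerSet_faces hσ).2 (fun a ha => hl a (List.mem_toFinset.1 ha)) ?_
  exact List.toFinset_nonempty_iff _ |>.2 h

/-- The point of the realization with given barycentric coordinates in a face. -/
noncomputable def extend [DecidableEq V] {τ : Finset V} (hτ : τ ∈ X.faces)
    (x : stdSimplex ℝ τ) : Realization X :=
  ⟨fun a => if h : a ∈ τ then x.1 ⟨a, h⟩ else 0, fun a => by
    dsimp only
    split_ifs with h
    exacts [x.2.1 _, le_rfl], τ, hτ, fun a ha => by simp [ha], by
    rw [← Finset.sum_coe_sort]
    simpa using x.2.2⟩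

/-- The map factors through the closed simplex, where continuity is coordinatewise; the inclusion is
continuous by definition of the coherent topology. -/
lemma continuous_extend [DecidableEq V] {τ : Finset V} (hτ : τ ∈ X.faces) :
    Continuous (extend hτ) := by
  let j : stdSimplex ℝ τ → ClosedSimplex X τ := fun x => ⟨extend hτ x, fun a ha => by
    simp [extend, ha]⟩
  have hj : Continuous j := by
    refine continuous_induced_rng.2 (continuous_pi fun a => ?_)
    by_cases h : a ∈ τ
    · have : (fun x : stdSimplex ℝ τ => (j x).1.1 a) = fun x => x.1 ⟨a, h⟩ := by
        ext x; simp [j, extend, h]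
      simpa [Function.comp_def, this] using! (continuous_apply _).comp continuous_subtype_val
    · have : (fun x : stdSimplex ℝ τ => (j x).1.1 a) = fun x => 0 := by
        ext x; simp [j, extend, h]
      simpa [Function.comp_def, this] using! continuous_const
  have h2 : Continuous (fun x : ClosedSimplex X τ => x.1) := by
    rw [continuous_iff_coinduced_le]
    exact le_iSup (fun σ : X.faces => TopologicalSpace.coinduced
      (fun x : ClosedSimplex X (σ : Finset V) => x.1) inferInstance) ⟨τ, hτ⟩
  exact h2.comp hj

lemma exists_peak (x : Realization X) : ∃ a, 0 < x.1 a ∧ ∀ b, x.1 b ≤ x.1 a := by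
  obtain ⟨h0, σ, hσ, hσ0, hσ1⟩ := x.2
  have hne : σ.Nonempty := (X.isRelLowerSet_faces hσ).1
  obtain ⟨a, ha, hmax⟩ := σ.exists_max_image x.1 hne
  have hpos : 0 < x.1 a := by
    by_contra hcon
    have : ∑ b ∈ σ, x.1 b ≤ 0 := Finset.sum_nonpos fun b hb => (hmax b hb).trans (not_lt.1 hcon)
    linarith
  refine ⟨a, hpos, fun b => ?_⟩
  by_cases hb : b ∈ σ
  · exact hmax b hb
  · rw [hσ0 b hb]; exact hpos.le

/-- A vertex with maximal barycentric coordinate. -/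
noncomputable def peak (x : Realization X) : V := (exists_peak x).choose

lemma peak_pos (x : Realization X) : 0 < x.1 (peak x) := (exists_peak x).choose_spec.1

lemma le_peak (x : Realization X) (b : V) : x.1 b ≤ x.1 (peak x) := (exists_peak x).choose_spec.2 b

/-- The points with a coordinate in `σ` that dominates all coordinates outside `σ`. -/
def peakSet (X : AbstractSimplicialComplex V) (σ : Finset V) : Set (Realization X) :=
  {x | ∃ a ∈ σ, 0 < x.1 a ∧ ∀ b, b ∉ σ → x.1 b < x.1 a}

lemma peak_mem {σ : Finset V} {x : Realization X} (hx : x ∈ peakSet X σ) : peak x ∈ σ := by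
  obtain ⟨a, _, _, h⟩ := hx
  by_contra hcon
  exact absurd (le_peak x a) (not_le.2 (h _ hcon))

lemma mem_peakSet {σ : Finset V} {x : Realization X} (h : ∀ a, a ∉ σ → x.1 a = 0) :
    x ∈ peakSet X σ := by
  refine ⟨peak x, ?_, peak_pos x, fun b hb => by rw [h b hb]; exact peak_pos x⟩
  by_contra hcon
  exact absurd (h _ hcon) (peak_pos x).ne'

lemma exists_mem_peakSet (x : Realization X) : ∃ σ ∈ X.faces, x ∈ peakSet X σ := by
  obtain ⟨_, σ, hσ, hσ0, _⟩ := x.2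
  exact ⟨σ, hσ, mem_peakSet hσ0⟩

/-- On a closed simplex `τ` the coordinates outside `τ` vanish, so only the finitely many vertices
of `τ \ σ` impose a condition. -/
lemma isOpen_peakSet (σ : Finset V) : IsOpen (peakSet X σ) := by
  classical
  rw [isOpen_iSup_iff]
  rintro ⟨τ, hτ⟩
  rw [isOpen_coinduced]
  have hc : ∀ a, Continuous fun x : ClosedSimplex X τ => x.1.1 a := fun a =>
    (continuous_apply a).comp continuous_induced_dom
  have : (fun x : ClosedSimplex X τ => x.1) ⁻¹' peakSet X σ =
      ⋃ a ∈ σ, ({x | 0 < x.1.1 a} ∩ ⋂ b ∈ τ \ σ, {x | x.1.1 b < x.1.1 a}) := by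
    ext x
    simp only [peakSet, Set.mem_preimage, Set.mem_ofPred_eq, Set.mem_iUnion, Set.mem_inter_iff,
      Set.mem_iInter, Finset.mem_sdiff, exists_prop]
    refine exists_congr fun a => and_congr_right fun _ => and_congr_right fun ha =>
      ⟨fun h b hb => h b hb.2, fun h b hb => ?_⟩
    by_cases hbτ : b ∈ τ
    · exact h b ⟨hbτ, hb⟩
    · rw [x.2 b hbτ]; exact ha
  rw [this]
  exact isOpen_biUnion fun a _ => (isOpen_lt continuous_const (hc a)).inter
    (isOpen_biInter_finset fun b _ => isOpen_lt (hc b) (hc a))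

/-- Lists of points of the closed simplex spanned by `l` whose coordinates differ pairwise by less
than `ε`. -/
def fineLists (X : AbstractSimplicialComplex V) (ε : ℝ) (l : List V) :
    Set (List (Realization X)) :=
  {m | (∀ x ∈ m, ∀ a, a ∉ l → x.1 a = 0) ∧ ∀ x ∈ m, ∀ y ∈ m, ∀ a, |x.1 a - y.1 a| < ε}

/-- The coordinates of a point in a face. -/
def restrict (τ : Finset V) (x : Realization X) : τ → ℝ := fun a => x.1 a

lemma restrict_mem {τ : Finset V} {x : Realization X} (h : ∀ a, a ∉ τ → x.1 a = 0) :
    restrict τ x ∈ stdSimplex ℝ τ := by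
  classical
  obtain ⟨h0, σ, hσ, hσ0, hσ1⟩ := x.2
  refine ⟨fun a => h0 a, ?_⟩
  simp only [restrict]
  rw [Finset.sum_coe_sort τ x.1]
  have h1 : ∑ a ∈ τ, x.1 a = ∑ a ∈ τ ∪ σ, x.1 a :=
    Finset.sum_subset Finset.subset_union_left fun a _ ha => h a ha
  rw [h1]
  exact (Finset.sum_subset Finset.subset_union_right fun a _ ha => hσ0 a ha).symm.trans hσ1

lemma extend_restrict [DecidableEq V] {τ : Finset V} (hτ : τ ∈ X.faces) {x : Realization X}
    (h : ∀ a, a ∉ τ → x.1 a = 0) : extend hτ ⟨restrict τ x, restrict_mem h⟩ = x := by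
  refine Subtype.ext (funext fun a => ?_)
  by_cases ha : a ∈ τ
  · simp [extend, ha, restrict]
  · simp [extend, ha, h a ha]

/-- Barycentric coordinates identify the closed simplex with a standard simplex. In the sup metric
the fine lists become its Vietoris-Rips complex. -/
lemma acyclic_fineLists {R : Type u} [CommRing R] {ε : ℝ} (hε : 0 < ε) {l : List V}
    (hl : l ∈ faceLists X) (hne : l ≠ []) : Chains.Acyclic R (fineLists X ε l) := by
  classical
  have hτ := toFinset_mem_faces hl hne
  set τ := l.toFinset with hτdef
  have hmemτ : ∀ a, a ∈ τ ↔ a ∈ l := fun a => by simp [hτdef]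
  obtain ⟨a₀, ha₀⟩ := (X.isRelLowerSet_faces hτ).1
  have : Nonempty τ := ⟨⟨a₀, ha₀⟩⟩
  let p : stdSimplex ℝ τ := ⟨Pi.single ⟨a₀, ha₀⟩ 1, single_mem_stdSimplex ℝ _⟩
  let j : (τ → ℝ) → Realization X := fun x =>
    if h : x ∈ stdSimplex ℝ τ then extend hτ ⟨x, h⟩ else extend hτ p
  have hjval : ∀ (x) (hx : x ∈ stdSimplex ℝ τ), j x = extend hτ ⟨x, hx⟩ := fun x hx => dif_pos hx
  have hr : ∀ m ∈ fineLists X ε l,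
      m.map (restrict τ) ∈ Chains.rips (stdSimplex ℝ τ) ε := by
    intro m hm
    constructor
    · intro x hx
      obtain ⟨x, hxm, rfl⟩ := List.mem_map.1 hx
      exact restrict_mem fun a ha => hm.1 x hxm a (by rwa [← hmemτ])
    · intro x hx y hy
      obtain ⟨x, hxm, rfl⟩ := List.mem_map.1 hx
      obtain ⟨y, hym, rfl⟩ := List.mem_map.1 hy
      rw [dist_pi_lt_iff hε]
      intro a
      exact hm.2 x hxm y hym a
  have hj : ∀ m ∈ Chains.rips (stdSimplex ℝ τ) ε, m.map j ∈ fineLists X ε l := by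
    intro m hm
    constructor
    · intro x hx a ha
      obtain ⟨x, hxm, rfl⟩ := List.mem_map.1 hx
      rw [hjval x (hm.1 x hxm)]
      rw [← hmemτ] at ha
      simp [extend, ha]
    · intro x hx y hy a
      obtain ⟨x, hxm, rfl⟩ := List.mem_map.1 hx
      obtain ⟨y, hym, rfl⟩ := List.mem_map.1 hy
      rw [hjval x (hm.1 x hxm), hjval y (hm.1 y hym)]
      by_cases ha : a ∈ τ
      · have := (dist_pi_lt_iff hε).1 (hm.2 x hxm y hym) ⟨a, ha⟩
        simpa [extend, ha, Real.dist_eq] using this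
      · simpa [extend, ha] using hε
  intro z hz hz0
  obtain ⟨w, hw, hw'⟩ := Chains.acyclic_rips (R := R) (convex_stdSimplex ℝ τ)
    (bounded_stdSimplex (ι := τ)) p.2 hε (Chains.map (restrict τ) z) (Chains.map_mem hr hz)
    (by rw [Chains.boundary_map, hz0, map_zero])
  refine ⟨Chains.map j w, Chains.map_mem hj hw, ?_⟩
  rw [Chains.boundary_map, hw']
  have := Chains.eq_of_supported (T := Chains.map j ∘ₗ Chains.map (restrict τ))
    (T' := LinearMap.id) (fun m hm => ?_) hz
  · simpa using this
  · simp only [LinearMap.comp_apply, Chains.map_single, LinearMap.id_apply, List.map_map]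
    congr 1
    conv_rhs => rw [← List.map_id m]
    refine List.map_congr_left fun x hx => ?_
    have h0 : ∀ a, a ∉ τ → x.1 a = 0 := fun a ha => hm.1 x hx a (by rwa [← hmemτ])
    simp [hjval _ (restrict_mem h0), extend_restrict hτ h0]

end Geometry

/-! ### Exactness of the ordered chains of a contractible complex. -/

section Contractible

variable {V : Type v} {X : AbstractSimplicialComplex V}

/-- Lists of points of the realization contained in a common `peakSet`. -/
def smallLists (X : AbstractSimplicialComplex V) : Set (List (Realization X)) :=
  {m | ∃ σ ∈ X.faces, ∀ x ∈ m, x ∈ peakSet X σ}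

/-- A homotopy carries sufficiently fine lists, at nearby times, into a common `peakSet`. -/
lemma exists_fineness [Nonempty V]
    (H : unitInterval × Realization X → Realization X) (hH : Continuous H) {l : List V}
    (hl : l ∈ faceLists X) :
    ∃ δ > 0, ∀ m ∈ fineLists X δ l, ∀ s t : unitInterval, dist s t < δ →
      ∃ σ ∈ X.faces, ∀ x ∈ m, H (s, x) ∈ peakSet X σ ∧ H (t, x) ∈ peakSet X σ := by
  classical
  have hempty : ∃ σ, σ ∈ X.faces := ⟨_, X.singleton_mem (Classical.arbitrary V)⟩
  rcases eq_or_ne l [] with rfl | hne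
  · refine ⟨1, one_pos, fun m hm s t _ => ?_⟩
    obtain ⟨σ, hσ⟩ := hempty
    refine ⟨σ, hσ, fun x hx => ?_⟩
    exact absurd (hm.1 x hx (peak x) (by simp)) (peak_pos x).ne'
  have hτ := toFinset_mem_faces hl hne
  set τ := l.toFinset with hτdef
  have hmemτ : ∀ a, a ∈ τ ↔ a ∈ l := fun a => by simp [hτdef]
  let f : unitInterval × stdSimplex ℝ τ → Realization X := fun p => H (p.1, extend hτ p.2)
  have hf : Continuous f :=
    hH.comp (continuous_fst.prodMk ((continuous_extend hτ).comp continuous_snd))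
  have : CompactSpace (stdSimplex ℝ τ) := isCompact_iff_compactSpace.1 (isCompact_stdSimplex ℝ τ)
  -- A Lebesgue number for the cover of the compact space `[0, 1] × τ` by preimages of peak sets. In
  -- the max metric, one ball around `(s, x₀)` contains every `(s, x)` and `(t, x)`.
  obtain ⟨δ, hδ, hLeb⟩ := lebesgue_number_lemma_of_metric (ι := X.faces)
    (c := fun σ => f ⁻¹' peakSet X σ) (isCompact_univ (X := unitInterval × stdSimplex ℝ τ))
    (fun σ => (isOpen_peakSet _).preimage hf) (fun p _ => by
      obtain ⟨σ, hσ, h⟩ := exists_mem_peakSet (f p)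
      exact Set.mem_iUnion.2 ⟨⟨σ, hσ⟩, h⟩)
  refine ⟨δ, hδ, fun m hm s t hst => ?_⟩
  rcases m with _ | ⟨x₀, m⟩
  · obtain ⟨σ, hσ⟩ := hempty
    exact ⟨σ, hσ, by simp⟩
  have h0 : ∀ x ∈ x₀ :: m, ∀ a, a ∉ τ → x.1 a = 0 := fun x hx a ha =>
    hm.1 x hx a (by rwa [← hmemτ])
  let r : ∀ x ∈ x₀ :: m, stdSimplex ℝ τ := fun x hx => ⟨restrict τ x, restrict_mem (h0 x hx)⟩
  have hd : ∀ (x) (hx : x ∈ x₀ :: m), dist (r x hx) (r x₀ (by simp)) < δ := fun x hx => by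
    rw [Subtype.dist_eq, dist_pi_lt_iff hδ]
    exact fun a => hm.2 x hx x₀ (by simp) a
  obtain ⟨⟨σ, hσ⟩, hball⟩ := hLeb (s, r x₀ (by simp)) (Set.mem_univ _)
  refine ⟨σ, hσ, fun x hx => ⟨?_, ?_⟩⟩
  · have : (s, r x hx) ∈ f ⁻¹' peakSet X σ := hball (by
      rw [Metric.mem_ball, Prod.dist_eq]
      exact max_lt (by simpa using hδ) (hd x hx))
    simpa [f, r, extend_restrict hτ (h0 x hx)] using this
  · have : (t, r x hx) ∈ f ⁻¹' peakSet X σ := hball (by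
      rw [Metric.mem_ball, Prod.dist_eq]
      exact max_lt (by simpa [dist_comm] using hst) (hd x hx))
    simpa [f, r, extend_restrict hτ (h0 x hx)] using this

lemma fineLists_mono {δ ε : ℝ} (h : δ ≤ ε) (l : List V) : fineLists X δ l ⊆ fineLists X ε l :=
  fun _ hm => ⟨hm.1, fun x hx y hy a => (hm.2 x hx y hy a).trans_le h⟩

/-- The augmented ordered chain complex of a contractible simplicial complex is exact. -/
theorem acyclic_faceLists (R : Type u) [CommRing R] [ContractibleSpace (Realization X)] :
    Chains.Acyclic R (faceLists X) := by
  classical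
  intro z hz hz0
  obtain ⟨y, ⟨H⟩⟩ := id_nullhomotopic (Realization X)
  have hV : Nonempty V := ⟨peak y⟩
  -- Only the finitely many lists of `z` matter: bounding lengths allows a finite induction for the
  -- carriers, and one fineness `δ` serves all of them.
  let N := z.support.sup List.length
  let K : Set (List V) := faceLists X ∩ {l | l.length ≤ N}
  have hK : ∀ l ∈ K, ∀ m, m.Sublist l → m ∈ K := fun l hl m hm =>
    ⟨faceLists_of_subset hl.1 hm.subset, hm.length_le.trans hl.2⟩
  have hzK : (z.support : Set (List V)) ⊆ K := fun l hl =>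
    ⟨hz hl, Finset.le_sup (f := List.length) hl⟩
  obtain ⟨δ, hδ, hfine⟩ : ∃ δ > 0, ∀ l ∈ (z.support : Set (List V)), ∀ m ∈ fineLists X δ l,
      ∀ s t : unitInterval, dist s t < δ →
      ∃ σ ∈ X.faces, ∀ x ∈ m, H (s, x) ∈ peakSet X σ ∧ H (t, x) ∈ peakSet X σ := by
    have h1 : ∀ᶠ δ in 𝓝[>] (0 : ℝ), ∀ l ∈ (z.support : Set (List V)), ∀ m ∈ fineLists X δ l,
        ∀ s t : unitInterval, dist s t < δ →
        ∃ σ ∈ X.faces, ∀ x ∈ m, H (s, x) ∈ peakSet X σ ∧ H (t, x) ∈ peakSet X σ := by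
      refine (eventually_all_finite z.support.finite_toSet).2 fun l hl => ?_
      obtain ⟨δ, hδ, h⟩ := exists_fineness H H.continuous (hz hl)
      filter_upwards [Ioc_mem_nhdsGT hδ] with δ' hδ' m hm s t hst
      exact h m (fineLists_mono hδ'.2 l hm) s t (hst.trans_le hδ'.2)
    obtain ⟨δ, h, hδ⟩ := (h1.and self_mem_nhdsWithin).exists
    exact ⟨δ, hδ, h⟩
  -- a chain map into fine chains
  obtain ⟨s, hs0, hs⟩ := Chains.exists_carried (R := R) hK (fineLists X δ)
    (fun l m hml x hx => ⟨fun y hy a ha => hx.1 y hy a fun h => ha (hml.subset h), hx.2⟩)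
    (fun l hl hne => acyclic_fineLists hδ hl.1 hne) 0 1 (by simp) (by simp)
    (Finsupp.single [] 1) (Chains.single_mem (by simp [fineLists]) 1) (by simp) N
  have hsb : ∀ c ∈ Finsupp.supported R R K, Chains.boundary (s c) = s (Chains.boundary c) :=
    fun c hc => Chains.eq_of_supported (T := Chains.boundary ∘ₗ s) (T' := s ∘ₗ Chains.boundary)
      (fun l hl => by simpa using (hs l hl hl.2).2) hc
  have hKb : ∀ l ∈ K, Chains.boundary (Finsupp.single l (1 : R)) ∈ Finsupp.supported R R K :=
    fun l hl => Chains.boundary_mem hK (Chains.single_mem hl 1)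
  -- its composite with `peak` is homotopic to the identity
  let θ : Chains R V →ₗ[R] Chains R V := LinearMap.id - Chains.map peak ∘ₗ s
  obtain ⟨T, -, hT⟩ := Chains.exists_carried (R := R) hK (fun l => {m | m ⊆ l})
    (fun l m hml x hx => List.Subset.trans hx hml.subset)
    (fun l hl hne => by
      obtain ⟨a, l', rfl⟩ := List.exists_cons_of_ne_nil hne
      exact Chains.acyclic_of_cone a fun m hm => List.cons_subset.2 ⟨by simp, hm⟩)
    -- The equation solved is `∂ T + T ∂ = 1 - peak ∘ s`. The carrier of `l` is the set of lists
    -- with entries in `l`; it contains `peak ∘ s`, since a peak has positive coordinate.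
    θ (-1)
    (fun l hl => by
      refine Submodule.sub_mem _ (Chains.single_mem (List.Subset.refl l) 1)
        (Chains.map_mem (fun m hm b hb => ?_) (hs l hl hl.2).1)
      obtain ⟨x, hx, rfl⟩ := List.mem_map.1 hb
      by_contra hcon
      exact (peak_pos x).ne' (hm.1 x hx _ hcon))
    (fun l hl => by simp [θ, hsb _ (Chains.single_mem hl 1)])
    0 (Submodule.zero_mem _) (by simp [θ, hs0]) N
  have hzs : z ∈ Finsupp.supported R R (z.support : Set (List V)) :=
    Finsupp.mem_supported_support R z
  have hzKs := Chains.supported_mono hzK hzs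
  have hTz : Chains.boundary (T z) = z - Chains.map peak (s z) := by
    have := Chains.eq_of_supported (T := Chains.boundary ∘ₗ T)
      (T' := θ - T ∘ₗ Chains.boundary) (fun l hl => by
        simpa [sub_eq_add_neg] using (hT l hl hl.2).2) hzKs
    simpa [θ, hz0] using this
  have hTmem : T z ∈ Finsupp.supported R R (faceLists X) :=
    Chains.map_mem_of_supported T _ (fun l hl => Chains.supported_mono
      (fun m hm => faceLists_of_subset hl.1 hm) (hT l hl hl.2).1) hzKs
  -- the fine cycle bounds by small chains
  have hsz0 : Chains.boundary (s z) = 0 := by rw [hsb z hzKs, hz0, map_zero]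
  let KA : Set (List (Realization X)) := {m | ∃ l ∈ z.support, m ∈ fineLists X δ l}
  have hszA : s z ∈ Finsupp.supported R R KA :=
    Chains.map_mem_of_supported s _ (fun l hl => Chains.supported_mono
      (K' := KA) (fun m hm => ⟨l, hl, hm⟩) (hs l (hzK hl) (hzK hl).2).1) hzs
  -- Consecutive times `j / M` differ by `1 / M < δ`, the step size allowed by the Lebesgue number.
  obtain ⟨M, hM⟩ := exists_nat_gt (1 / δ)
  have hMpos : (0 : ℝ) < M := lt_trans (by positivity) hM
  let τ : ℕ → unitInterval := fun j => Set.projIcc 0 1 zero_le_one ((j : ℝ) / M)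
  have hτ : ∀ j, dist (τ j) (τ (j + 1)) < δ := by
    intro j
    have h1 : dist (τ j) (τ (j + 1)) ≤ |(j : ℝ) / M - ((j + 1 : ℕ) : ℝ) / M| := by
      have := (LipschitzWith.projIcc (zero_le_one (α := ℝ))).dist_le_mul
        ((j : ℝ) / M) (((j + 1 : ℕ) : ℝ) / M)
      simpa [Real.dist_eq, τ] using this
    have h2 : (j : ℝ) / M - ((j + 1 : ℕ) : ℝ) / M = - (1 / M) := by push_cast; ring
    rw [h2, abs_neg, abs_of_pos (by positivity)] at h1
    refine h1.trans_lt ?_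
    rw [div_lt_iff₀ hMpos]
    rw [div_lt_iff₀ hδ] at hM
    linarith
  have hL : ∀ l ∈ smallLists X, ∀ m, m ⊆ l → m ∈ smallLists X := fun l hl m hm => by
    obtain ⟨σ, hσ, h⟩ := hl
    exact ⟨σ, hσ, fun x hx => h x (hm hx)⟩
  obtain ⟨w, hw, hw'⟩ := Chains.exists_boundary_eq_sub (R := R) hL (fun j x => H (τ j, x)) M
    (fun j _ m hm => by
      obtain ⟨l, hl, hm⟩ := hm
      obtain ⟨σ, hσ, h⟩ := hfine l hl m hm _ _ (hτ j)
      refine ⟨σ, hσ, fun x hx => ?_⟩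
      simp only [List.mem_append, List.mem_map] at hx
      rcases hx with ⟨x, hx, rfl⟩ | ⟨x, hx, rfl⟩
      exacts [(h x hx).1, (h x hx).2]) hszA hsz0
  have h0 : Chains.map (fun x => H (τ 0, x)) (s z) = s z := by
    have h1 : (fun x => H (τ 0, x)) = id := by
      ext1 x
      have : τ 0 = 0 := by
        simp only [τ, Nat.cast_zero, zero_div]
        exact Set.projIcc_left _
      simp [this]
    have h2 : (Chains.map id : Chains R (Realization X) →ₗ[R] _) = LinearMap.id :=
      Chains.hom_ext fun l => by simp
    rw [h1, h2, LinearMap.id_apply]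
  have h1 : ∀ x, H (τ M, x) = y := fun x => by
    have : τ M = 1 := by
      simp only [τ, div_self hMpos.ne']
      exact Set.projIcc_right _
    simp [this]
  have hmap1 : Chains.map (fun x => H (τ M, x)) (s z) ∈
      Finsupp.supported R R {l | ∀ x ∈ l, x = y} :=
    Chains.map_mem (K := Set.univ) (fun l _ x hx => by
      obtain ⟨x', _, rfl⟩ := List.mem_map.1 hx
      exact h1 x') (by simp)
  obtain ⟨w', hw1, hw2⟩ := Chains.acyclic_of_cone (K := {l : List (Realization X) | ∀ x ∈ l, x = y})
    y (fun l hl x hx => by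
      rcases List.mem_cons.1 hx with rfl | hx
      exacts [rfl, hl x hx]) _ hmap1 (by rw [Chains.boundary_map, hsz0, map_zero])
  have hsmall : {l : List (Realization X) | ∀ x ∈ l, x = y} ⊆ smallLists X := fun l hl => by
    obtain ⟨σ, hσ, h⟩ := exists_mem_peakSet y
    exact ⟨σ, hσ, fun x hx => by rw [hl x hx]; exact h⟩
  -- Here `∂ (w' - w) = s z` and `∂ (T z) = z - peak (s z)`, so the sum bounds `z`. Small lists go
  -- to faces because the peak of a point of `peakSet X σ` lies in `σ`.
  refine ⟨Chains.map peak (w' - w) + T z, Submodule.add_mem _ (Chains.map_mem (fun m hm => ?_)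
    (Submodule.sub_mem _ (Chains.supported_mono hsmall hw1) hw)) hTmem, ?_⟩
  · obtain ⟨σ, hσ, h⟩ := hm
    refine ⟨σ, hσ, fun a ha => ?_⟩
    obtain ⟨x, hx, rfl⟩ := List.mem_map.1 ha
    exact peak_mem (h x hx)
  · rw [map_add, Chains.boundary_map, map_sub, hw2, hw', h0, hTz]
    simp

end Contractible

/-! ### Antisymmetrization of ordered chains. -/

namespace Chains

section Alternation

variable {R : Type u} [CommRing R] {V : Type v} {W : Type w}

/-- The signed sum of all insertions of a vertex into a list. -/
noncomputable def insertList (R : Type u) [CommRing R] {V : Type v} (a : V) : List V → Chains R V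
  | [] => Finsupp.single [a] 1
  | b :: l => Finsupp.single (a :: b :: l) 1 - cons b (insertList R a l)

/-- The linear extension of `insertList`. -/
noncomputable def insert (a : V) : Chains R V →ₗ[R] Chains R V :=
  Finsupp.linearCombination R (insertList R a)

lemma insert_nil (a : V) :
    insert a (Finsupp.single ([] : List V) (1 : R)) = Finsupp.single [a] 1 := by
  simp [insert, insertList]

lemma insert_cons (a b : V) (c : Chains R V) :
    insert a (cons b c) = cons a (cons b c) - cons b (insert a c) := by
  have : insert a ∘ₗ cons b = cons a ∘ₗ cons b - (cons b (R := R)) ∘ₗ insert a :=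
    hom_ext fun l => by simp [insert, insertList]
  simpa using LinearMap.congr_fun this c

/-- The sum of all replacements of an entry of a list by a given vertex. -/
noncomputable def replaceList (R : Type u) [CommRing R] {V : Type v} (a : V) :
    List V → Chains R V
  | [] => 0
  | b :: l => Finsupp.single (a :: l) 1 + cons b (replaceList R a l)

/-- The linear extension of `replaceList`. -/
noncomputable def replace (a : V) : Chains R V →ₗ[R] Chains R V :=
  Finsupp.linearCombination R (replaceList R a)

lemma replace_nil (a : V) : replace a (Finsupp.single ([] : List V) (1 : R)) = 0 := by
  simp [replace, replaceList]

lemma replace_cons (a b : V) (c : Chains R V) :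
    replace a (cons b c) = cons a c + cons b (replace a c) := by
  have : replace a ∘ₗ cons b = cons a + (cons b (R := R)) ∘ₗ replace a :=
    hom_ext fun l => by simp [replace, replaceList]
  simpa using LinearMap.congr_fun this c

/-- The signed sum of all reorderings of a list. -/
noncomputable def antisymList (R : Type u) [CommRing R] {V : Type v} : List V → Chains R V
  | [] => Finsupp.single [] 1
  | a :: l => insert a (antisymList R l)

/-- The linear extension of `antisymList`. -/
noncomputable def antisym : Chains R V →ₗ[R] Chains R V :=
  Finsupp.linearCombination R (antisymList R)

lemma antisym_single (l : List V) : antisym (Finsupp.single l (1 : R)) = antisymList R l := by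
  simp [antisym]

lemma antisym_cons (a : V) (c : Chains R V) : antisym (cons a c) = insert a (antisym c) := by
  have : antisym ∘ₗ cons a = (insert a (R := R)) ∘ₗ antisym :=
    hom_ext fun l => by simp [antisym, antisymList]
  simpa using LinearMap.congr_fun this c

lemma insert_insert (a b : V) (c : Chains R V) :
    insert a (insert b c) = - insert b (insert a c) := by
  have : insert a ∘ₗ insert b = - ((insert b (R := R)) ∘ₗ insert a) := by
    refine hom_ext fun l => ?_
    induction l with
    | nil =>
      simp only [LinearMap.comp_apply, LinearMap.neg_apply, insert_nil, single_cons, insert_cons]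
      abel
    | cons x l ih =>
      simp only [LinearMap.comp_apply, LinearMap.neg_apply] at ih ⊢
      simp only [single_cons, insert_cons, map_sub, ih, map_neg]
      abel
  simpa using LinearMap.congr_fun this c

lemma replace_insert (a b : V) (c : Chains R V) :
    replace a (insert b c) = insert b (replace a c) + insert a c := by
  have : replace a ∘ₗ insert b = insert b ∘ₗ replace a + insert (R := R) a := by
    refine hom_ext fun l => ?_
    induction l with
    | nil =>
      simp only [LinearMap.comp_apply, LinearMap.add_apply, insert_nil, replace_nil, single_cons,
        replace_cons, map_zero, add_zero, zero_add]
    | cons x l ih =>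
      simp only [LinearMap.comp_apply, LinearMap.add_apply] at ih ⊢
      simp only [single_cons, insert_cons, replace_cons, map_sub, map_add, ih]
      abel
  simpa using LinearMap.congr_fun this c

lemma replace_antisym (a : V) (c : Chains R V) :
    replace a (antisym c) = antisym (replace a c) := by
  have : replace a ∘ₗ antisym = antisym ∘ₗ replace (R := R) a := by
    refine hom_ext fun l => ?_
    induction l with
    | nil => simp [antisym_single, antisymList, replace_nil]
    | cons x l ih =>
      simp only [LinearMap.comp_apply] at ih ⊢
      simp only [single_cons, antisym_cons, replace_cons, map_add, replace_insert, ih]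
      abel
  simpa using LinearMap.congr_fun this c

/-- Moving the replacing vertex from its position to the front costs precisely the sign of the
corresponding face. -/
lemma antisym_replace (a : V) (c : Chains R V) :
    antisym (replace a c) = antisym (cons a (boundary c)) := by
  have : antisym ∘ₗ replace a = antisym ∘ₗ cons a ∘ₗ boundary (R := R) := by
    refine hom_ext fun l => ?_
    induction l with
    | nil => simp [replace_nil]
    | cons x l ih =>
      simp only [LinearMap.comp_apply] at ih ⊢
      simp only [single_cons, antisym_cons, replace_cons, map_add, map_sub, boundary_cons, ih]
      rw [insert_insert x a]
      abel
  simpa using LinearMap.congr_fun this c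

/-- Deleting the inserted `a` returns `c` once for each of the `p + 1` positions. Deleting another
entry commutes with insertion up to sign, except that the two insertions adjacent to that entry give
the same list; this double count leaves `replace a c`. -/
lemma boundary_insert (a : V) {p : ℕ} {c : Chains R V}
    (hc : c ∈ Finsupp.supported R R {l : List V | l.length = p}) :
    boundary (insert a c) = ((p : R) + 1) • c - insert a (boundary c) - replace a c := by
  have : ∀ l : List V, boundary (insert a (Finsupp.single l (1 : R))) =
      ((l.length : R) + 1) • Finsupp.single l 1 - insert a (boundary (Finsupp.single l 1))
        - replace a (Finsupp.single l 1) := by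
    intro l
    induction l with
    | nil =>
      simp only [insert_nil, replace_nil, single_cons, boundary_cons, boundary_nil, map_zero,
        List.length_nil, Nat.cast_zero]
      module
    | cons x l ih =>
      simp only [single_cons, insert_cons, replace_cons, map_sub, boundary_cons, ih,
        List.length_cons, map_smul, Nat.cast_add, Nat.cast_one]
      module
  have h := eq_of_supported (T := boundary ∘ₗ insert a) (T' := ((p : R) + 1) • LinearMap.id -
    insert a ∘ₗ boundary - replace a) (fun l (hl : l.length = p) => by
      subst hl; simpa using this l) hc
  simpa using h

lemma insertList_mem (a : V) (l : List V) :
    insertList R a l ∈ Finsupp.supported R R {m | m.Perm (a :: l)} := by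
  induction l with
  | nil => exact single_mem (K := {m : List V | m.Perm [a]}) (List.Perm.refl _) 1
  | cons b l ih =>
    refine Submodule.sub_mem _
      (single_mem (K := {m : List V | m.Perm (a :: b :: l)}) (List.Perm.refl _) 1) ?_
    exact cons_mem (K' := {m : List V | m.Perm (a :: b :: l)})
      (fun m (hm : m.Perm (a :: l)) => (hm.cons b).trans (List.Perm.swap _ _ _)) ih

lemma antisymList_mem (l : List V) :
    antisymList R l ∈ Finsupp.supported R R {m | m.Perm l} := by
  induction l with
  | nil => exact single_mem (K := {m : List V | m.Perm []}) (List.Perm.refl _) 1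
  | cons a l ih =>
    refine map_mem_of_supported _ _ (fun m (hm : m.Perm l) => ?_) ih
    rw [insert, Finsupp.linearCombination_single, one_smul]
    exact supported_mono (fun k (hk : k.Perm (a :: m)) => hk.trans (hm.cons a))
      (insertList_mem a m)

/-- The replacement term of `boundary_insert` equals one more copy of `insert a (antisym (∂ l))`,
raising the factor by one. Division by factorials thus makes `alt` a chain map. -/
lemma boundary_antisymList (l : List V) :
    boundary (antisymList R l) = (l.length : R) • antisym (boundary (Finsupp.single l 1)) := by
  induction l with
  | nil => simp [antisymList]
  | cons a l ih =>
    have hmem : antisymList R l ∈ Finsupp.supported R R {m | m.length = l.length} :=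
      supported_mono (fun m (hm : m.Perm l) => hm.length_eq) (antisymList_mem l)
    rw [antisymList, boundary_insert a hmem, ih, ← antisym_single, replace_antisym,
      antisym_replace]
    simp only [single_cons, boundary_cons, map_sub, antisym_cons, map_smul, List.length_cons,
      Nat.cast_add, Nat.cast_one]
    module

lemma map_insert (f : V → W) (a : V) (c : Chains R V) :
    map f (insert a c) = insert (f a) (map f c) := by
  have : map f ∘ₗ insert a = insert (f a) ∘ₗ (map f : Chains R V →ₗ[R] _) := by
    refine hom_ext fun l => ?_
    induction l with
    | nil => simp [insert_nil]
    | cons x l ih =>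
      simp only [LinearMap.comp_apply] at ih ⊢
      simp only [single_cons, insert_cons, map_sub, map_cons, ih]
  simpa using LinearMap.congr_fun this c

lemma map_antisymList (f : V → W) (l : List V) :
    map f (antisymList R l) = antisymList R (l.map f) := by
  induction l with
  | nil => simp [antisymList]
  | cons a l ih => rw [antisymList, map_insert, ih, List.map_cons, antisymList]

end Alternation

section Field

variable {R : Type u} [Field R] {V : Type v} {W : Type w}

/-- The projection onto alternating chains. -/
noncomputable def alt : Chains R V →ₗ[R] Chains R V :=
  Finsupp.linearCombination R fun l => (l.length.factorial : R)⁻¹ • antisymList R l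

lemma alt_single (l : List V) :
    alt (Finsupp.single l (1 : R)) = (l.length.factorial : R)⁻¹ • antisymList R l := by
  simp [alt]

variable [CharZero R]

lemma insert_self (a : V) (c : Chains R V) : insert a (insert a c) = 0 := by
  have h := insert_insert a a c
  have h2 : (2 : R) • insert a (insert a c) = 0 := by
    rw [two_smul]; nth_rewrite 2 [h]; simp
  exact (smul_eq_zero.1 h2).resolve_left two_ne_zero

lemma antisymList_eq_zero (l : List V) (hl : ¬ l.Nodup) : antisymList R l = 0 := by
  induction hn : l.length generalizing l with
  | zero => simp [List.length_eq_zero_iff.1 hn] at hl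
  | succ n ih =>
    obtain _ | ⟨a, l⟩ := l
    · simp at hl
    by_cases hl' : l.Nodup
    · have ha : a ∈ l := by
        by_contra h
        exact hl (List.nodup_cons.2 ⟨h, hl'⟩)
      obtain _ | ⟨b, l⟩ := l
      · simp at ha
      rw [antisymList, antisymList]
      by_cases hab : a = b
      · rw [hab, insert_self]
      -- Exchanging the insertions of `a` and `b` exposes the shorter list `a :: l`, which still
      -- repeats `a`.
      · rw [insert_insert]
        have : antisymList R (a :: l) = 0 := by
          refine ih _ (fun h => ?_) (by simpa using hn)
          exact (List.nodup_cons.1 h).1 (by simpa [hab] using ha)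
        rw [antisymList] at this
        rw [this, map_zero, neg_zero]
    · rw [antisymList, ih l hl' (by simpa using hn), map_zero]

lemma alt_single_mem (l : List V) :
    alt (Finsupp.single l (1 : R)) ∈ Finsupp.supported R R {m | m.Perm l} := by
  rw [alt_single]
  exact Submodule.smul_mem _ _ (antisymList_mem l)

lemma alt_single_of_length_le_one {l : List V} (hl : l.length ≤ 1) :
    alt (Finsupp.single l (1 : R)) = Finsupp.single l 1 := by
  rw [alt_single]
  match l, hl with
  | [], _ => simp [antisymList]
  | [a], _ => simp [antisymList, insert_nil]

lemma alt_single_of_not_nodup {l : List V} (hl : ¬ l.Nodup) :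
    alt (Finsupp.single l (1 : R)) = 0 := by
  rw [alt_single, antisymList_eq_zero l hl, smul_zero]

lemma map_alt (f : V → W) (c : Chains R V) : map f (alt c) = alt (map f c) := by
  have : map f ∘ₗ alt = alt ∘ₗ (map f : Chains R V →ₗ[R] _) :=
    hom_ext fun l => by simp [alt_single, map_antisymList]
  simpa using LinearMap.congr_fun this c

lemma boundary_alt (c : Chains R V) : boundary (alt c) = alt (boundary c) := by
  have : boundary ∘ₗ alt = alt ∘ₗ boundary (R := R) (V := V) := by
    refine hom_ext fun l => ?_
    obtain _ | ⟨a, l⟩ := l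
    · simp [alt_single_of_length_le_one]
    -- All faces have the same length, so `alt` is a single multiple of `antisym` on the boundary.
    have h : alt (boundary (Finsupp.single (a :: l) (1 : R))) =
        ((l.length.factorial : R)⁻¹ • antisym) (boundary (Finsupp.single (a :: l) 1)) := by
      refine eq_of_supported (fun m hm => ?_) (by
        rw [boundary_single]; exact boundaryList_mem (a :: l))
      have hlen : m.length = l.length := by simpa using hm.2
      simp [alt_single, antisym_single, hlen]
    simp only [LinearMap.comp_apply]
    rw [h, alt_single, map_smul, boundary_antisymList, smul_smul, LinearMap.smul_apply]
    congr 1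
    have h1 : (l.length : R) + 1 ≠ 0 := Nat.cast_add_one_ne_zero _
    have h2 : (l.length.factorial : R) ≠ 0 := Nat.cast_ne_zero.2 (Nat.factorial_ne_zero _)
    simp only [List.length_cons, Nat.factorial_succ]
    push_cast
    field_simp
  simpa using LinearMap.congr_fun this c

end Field

end Chains

/-! ### Splitting boundaries by comparing projective resolutions. -/

section Abstract

variable {C : Type u} [Category.{v} C] [Abelian C]

/-- A projective resolution from an exact augmented complex of projectives. -/
noncomputable def resolutionOfExact {Z : C} (K : ChainComplex C ℕ) [∀ n, Projective (K.X n)]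
    (ε : K.X 0 ⟶ Z) [Epi ε] (w : K.d 1 0 ≫ ε = 0) (h0 : (ShortComplex.mk _ _ w).Exact)
    (h : ∀ n, (ShortComplex.mk _ _ (K.d_comp_d (n + 2) (n + 1) n)).Exact) :
    ProjectiveResolution Z where
  complex := K
  π := (ChainComplex.toSingle₀Equiv _ _).symm ⟨ε, w⟩
  quasiIso := ⟨fun n => by
    cases n
    · rw [ChainComplex.quasiIsoAt₀_iff, ShortComplex.quasiIso_iff_of_zeros']
      · refine (ShortComplex.exact_and_epi_g_iff_of_iso ?_).2 ⟨h0, by dsimp; infer_instance⟩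
        exact ShortComplex.isoMk (Iso.refl _) (Iso.refl _) (Iso.refl _)
          ((Category.id_comp _).trans (Category.comp_id _).symm) 
          ((Category.id_comp _).trans ((ChainComplex.toSingle₀Equiv_symm_apply_f_zero ε w).symm.trans
            (Category.comp_id _).symm))
      · exact K.shape _ _ (by simp)
      all_goals rfl
    · rw [quasiIsoAt_iff_exactAt']
      · rw [HomologicalComplex.exactAt_iff' _ _ _ _ (by simp; rfl) (by simp; rfl)]
        exact h _
      · apply ChainComplex.exactAt_succ_single_obj⟩

/-- If some resolution of `Z` has an endomorphism over the identity that vanishes in degree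
`n + 1`, then in every resolution the boundaries of degree `n` are split off by a map of the form
`1 - ∂ h`. -/
lemma exists_splitting {Z : C} (P Q : ProjectiveResolution Z) (a : Q.complex ⟶ Q.complex)
    (ha : a ≫ Q.π = Q.π) (n : ℕ) (hn : a.f (n + 1) = 0) :
    ∃ h : P.complex.X n ⟶ P.complex.X (n + 1),
      P.complex.d (n + 1) n ≫ h ≫ P.complex.d (n + 1) n = P.complex.d (n + 1) n := by
  -- Detouring through `Q` gives an endomorphism of `P` over the identity that factors through `a`,
  -- hence vanishes in degree `n + 1`.
  let φ : P.complex ⟶ P.complex :=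
    ProjectiveResolution.lift (𝟙 Z) P Q ≫ a ≫ ProjectiveResolution.lift (𝟙 Z) Q P
  let H : Homotopy (𝟙 P.complex) φ := ProjectiveResolution.liftHomotopy (𝟙 Z) _ _ (by simp)
    (by simp [φ, ha])
  refine ⟨H.hom n (n + 1), ?_⟩
  have h1 := H.comm n
  rw [prevD_eq H.hom (show (ComplexShape.down ℕ).Rel (n + 1) n from rfl)] at h1
  -- On boundaries, one term of the homotopy dies by `∂ ∂ = 0` and `φ` dies by its vanishing in
  -- degree `n + 1`; only `∂ h ∂ = ∂` remains.
  have h2 : P.complex.d (n + 1) n ≫ dNext n H.hom = 0 := by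
    simp [dNext]
  have h3 : P.complex.d (n + 1) n ≫ φ.f n = 0 := by
    rw [← φ.comm]
    simp [φ, hn]
  have h4 := congrArg (fun f => P.complex.d (n + 1) n ≫ f) h1
  simp only [Preadditive.comp_add, h2, h3, HomologicalComplex.id_f, Category.comp_id] at h4
  simpa using h4.symm

/-- The projector `1 - ∂ h` detects cocycles. -/
lemma exists_projector {Z : C} (P Q : ProjectiveResolution Z) (a : Q.complex ⟶ Q.complex)
    (ha : a ≫ Q.π = Q.π) (n : ℕ) (hn : a.f (n + 1) = 0) :
    ∃ e : P.complex.X n ⟶ P.complex.X n, e ≫ e = e ∧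
      ∀ {A : C} (f : P.complex.X n ⟶ A), e ≫ f = f ↔ P.complex.d (n + 1) n ≫ f = 0 := by
  obtain ⟨h, hh⟩ := exists_splitting P Q a ha n hn
  have h0 : P.complex.d (n + 1) n ≫ (𝟙 _ - h ≫ P.complex.d (n + 1) n) = 0 := by
    rw [Preadditive.comp_sub, hh]
    simp
  have key : ∀ {A : C} (f : P.complex.X n ⟶ A),
      (𝟙 _ - h ≫ P.complex.d (n + 1) n) ≫ f = f ↔ P.complex.d (n + 1) n ≫ f = 0 := by
    intro A f
    constructor
    · intro hf
      rw [← hf, ← Category.assoc, h0, Limits.zero_comp]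
    · intro hf
      simp [Preadditive.sub_comp, hf]
  -- Idempotence is the criterion applied to the projector itself, which kills boundaries.
  exact ⟨_, (key _).2 h0, key⟩

end Abstract

/-! ### Free permutation modules and their equivariant maps. -/

section Rep

variable {k G : Type u} [CommRing k] [Group G]

lemma rep_exact_iff (S : ShortComplex (Rep.{u} k G)) :
    S.Exact ↔ ∀ x : S.X₂, S.g.hom x = 0 → ∃ y : S.X₁, S.f.hom y = x := by
  rw [← ShortComplex.exact_map_iff_of_faithful S (forget₂ (Rep.{u} k G) (ModuleCat.{u} k)),
    ShortComplex.moduleCat_exact_iff]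
  rfl

/-- Vanishing of group cohomology in terms of a projective resolution. -/
lemma subsingleton_groupCohomology_iff (P : ProjectiveResolution (Rep.trivial k G k))
    (A : Rep.{u} k G) (n : ℕ) :
    Subsingleton (groupCohomology A n) ↔
      ∀ f : P.complex.X n ⟶ A, P.complex.d (n + 1) n ≫ f = 0 →
        ∃ g : P.complex.X ((ComplexShape.up ℕ).prev n) ⟶ A,
          P.complex.d n ((ComplexShape.up ℕ).prev n) ≫ g = f := by
  rw [← ModuleCat.isZero_iff_subsingleton, (groupCohomologyIso A n P).isZero_iff,
    ← HomologicalComplex.exactAt_iff_isZero_homology,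
    HomologicalComplex.exactAt_iff' _ _ n (n + 1) rfl (by simp),
    ShortComplex.moduleCat_exact_iff]
  rfl

/-- The permutation representation on the free module over a `G`-set. -/
noncomputable def permRep (k G : Type u) [CommRing k] [Group G] (T : Type u) [MulAction G T] :
    Representation k G (T →₀ k) where
  toFun g := Finsupp.lmapDomain k k (g • ·)
  map_one' := by ext; simp
  map_mul' g h := by ext; simp [mul_smul]

@[simp] lemma permRep_single {T : Type u} [MulAction G T] (g : G) (t : T) (r : k) :
    permRep k G T g (Finsupp.single t r) = Finsupp.single (g • t) r := by
  simp [permRep]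

/-- The chosen representative of the orbit of a point. -/
noncomputable def orbitOut (G : Type u) [Group G] {T : Type u} [MulAction G T]
    (ω : MulAction.orbitRel.Quotient G T) : T := Quotient.out ω

/-- The orbit of a point. -/
def orbitOf (G : Type u) [Group G] {T : Type u} [MulAction G T] (t : T) :
    MulAction.orbitRel.Quotient G T := Quotient.mk _ t

lemma orbitOf_smul {T : Type u} [MulAction G T] (g : G) (t : T) :
    orbitOf G (g • t) = orbitOf G t :=
  Quotient.sound (MulAction.mem_orbit t g)

lemma orbitOf_orbitOut {T : Type u} [MulAction G T] (ω : MulAction.orbitRel.Quotient G T) :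
    orbitOf G (orbitOut G ω) = ω := Quotient.out_eq ω

lemma exists_smul_orbitOut {T : Type u} [MulAction G T] (t : T) :
    ∃ g : G, g • orbitOut G (orbitOf G t) = t := by
  have h : (MulAction.orbitRel G T).r t (orbitOut G (orbitOf G t)) :=
    Quotient.exact (Quotient.out_eq (Quotient.mk (MulAction.orbitRel G T) t)).symm
  exact h

/-- A group element carrying the representative of an orbit to a given point. -/
noncomputable def orbitCoord (G : Type u) [Group G] {T : Type u} [MulAction G T] (t : T) : G :=
  (exists_smul_orbitOut t).choose

lemma orbitCoord_smul_orbitOut {T : Type u} [MulAction G T] (t : T) :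
    orbitCoord G t • orbitOut G (orbitOf G t) = t := (exists_smul_orbitOut t).choose_spec

/-- Freeness makes the element carrying the representative to a given point unique. -/
lemma orbitCoord_smul {T : Type u} [MulAction G T] (hT : ∀ (g : G) (t : T), g • t = t → g = 1)
    (g : G) (t : T) : orbitCoord G (g • t) = g * orbitCoord G t := by
  have h1 := orbitCoord_smul_orbitOut (G := G) (g • t)
  have h2 := orbitCoord_smul_orbitOut (G := G) t
  rw [orbitOf_smul] at h1
  have := hT ((g * orbitCoord G t)⁻¹ * orbitCoord G (g • t)) (orbitOut G (orbitOf G t)) (by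
    rw [mul_smul, h1, inv_smul_eq_iff, mul_smul, h2])
  rw [inv_mul_eq_one] at this
  exact this.symm

lemma orbitCoord_orbitOut {T : Type u} [MulAction G T]
    (hT : ∀ (g : G) (t : T), g • t = t → g = 1) (ω : MulAction.orbitRel.Quotient G T) :
    orbitCoord G (orbitOut G ω) = 1 := by
  refine hT _ (orbitOut G ω) ?_
  have := orbitCoord_smul_orbitOut (G := G) (orbitOut G ω)
  rwa [orbitOf_orbitOut] at this

/-- The equivariant map out of a free permutation module with given values on the
representatives of the orbits. -/
noncomputable def freeHom {T : Type u} [MulAction G T]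
    (hT : ∀ (g : G) (t : T), g • t = t → g = 1) (A : Rep.{u} k G)
    (a : MulAction.orbitRel.Quotient G T → A) : Rep.of (permRep k G T) ⟶ A :=
  Rep.ofHom ⟨Finsupp.linearCombination k fun t => A.ρ (orbitCoord G t) (a (orbitOf G t)), fun g => by
    ext t
    simp [orbitCoord_smul hT, orbitOf_smul]⟩

lemma freeHom_single {T : Type u} [MulAction G T]
    (hT : ∀ (g : G) (t : T), g • t = t → g = 1) (A : Rep.{u} k G)
    (a : MulAction.orbitRel.Quotient G T → A) (t : T) :
    (freeHom hT A a).hom (Finsupp.single t 1) = A.ρ (orbitCoord G t) (a (orbitOf G t)) := by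
  change Finsupp.linearCombination k _ (Finsupp.single t 1) = _
  simp

lemma perm_hom_ext {T : Type u} [MulAction G T] {A : Rep.{u} k G}
    {f f' : Rep.of (permRep k G T) ⟶ A}
    (h : ∀ t, f.hom (Finsupp.single t 1) = f'.hom (Finsupp.single t 1)) : f = f' := by
  ext1
  apply Representation.IntertwiningMap.toLinearMap_injective
  exact Finsupp.lhom_ext' fun t => LinearMap.ext_ring (h t)

lemma hom_single_eq {T : Type u} [MulAction G T] {A : Rep.{u} k G}
    (f : Rep.of (permRep k G T) ⟶ A) (t : T) :
    f.hom (Finsupp.single t 1) =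
      A.ρ (orbitCoord G t) (f.hom (Finsupp.single (orbitOut G (orbitOf G t)) 1)) := by
  rw [← Rep.hom_comm_apply]
  congr 1
  change _ = permRep k G T _ _
  rw [permRep_single, orbitCoord_smul_orbitOut]

lemma freeHom_orbitOut {T : Type u} [MulAction G T]
    (hT : ∀ (g : G) (t : T), g • t = t → g = 1) (A : Rep.{u} k G)
    (a : MulAction.orbitRel.Quotient G T → A) (ω : MulAction.orbitRel.Quotient G T) :
    (freeHom hT A a).hom (Finsupp.single (orbitOut G ω) 1) = a ω := by
  rw [freeHom_single, orbitCoord_orbitOut hT, orbitOf_orbitOut, map_one]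
  rfl

lemma freeHom_injective {T : Type u} [MulAction G T] (hT : ∀ (g : G) (t : T), g • t = t → g = 1) (A : Rep.{u} k G)
    {a b : MulAction.orbitRel.Quotient G T → A} (h : freeHom hT A a = freeHom hT A b) : a = b := by
  ext ω
  rw [← freeHom_orbitOut hT A a, h, freeHom_orbitOut]

lemma freeHom_surjective {T : Type u} [MulAction G T] (hT : ∀ (g : G) (t : T), g • t = t → g = 1) (A : Rep.{u} k G)
    (f : Rep.of (permRep k G T) ⟶ A) : ∃ a, freeHom hT A a = f :=
  ⟨fun ω => f.hom (Finsupp.single (orbitOut G ω) 1), perm_hom_ext fun t => by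
    rw [freeHom_single, ← hom_single_eq]⟩

lemma projective_permRep {T : Type u} [MulAction G T]
    (hT : ∀ (g : G) (t : T), g • t = t → g = 1) : Projective (Rep.of (permRep k G T)) where
  factors {E X} f e he := by
    rw [Rep.epi_iff_surjective] at he
    choose s hs using he
    refine ⟨freeHom hT E fun ω => s (f.hom (Finsupp.single (orbitOut G ω) 1)), ?_⟩
    refine perm_hom_ext fun t => ?_
    rw [Rep.hom_comp, Representation.IntertwiningMap.comp_apply, freeHom_single,
      Rep.hom_comm_apply, hs, ← hom_single_eq]

end Rep

/-! ### Equivariant complexes of lists and their resolutions. -/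

/-- A complex of lists in a `G`-set: a family of lists closed under passing to lists of entries
and under translation. -/
structure ListComplex (G : Type u) [Group G] (V : Type u) [MulAction G V] where
  /-- The lists of the complex. -/
  lists : Set (List V)
  subset_mem : ∀ l ∈ lists, ∀ m, m ⊆ l → m ∈ lists
  smul_mem : ∀ (g : G), ∀ l ∈ lists, l.map (g • ·) ∈ lists

namespace ListComplex

variable {k G V : Type u} [CommRing k] [Group G] [MulAction G V]
  (K : ListComplex G V)

/-- The lists with `p + 1` entries. -/
abbrev Simplex (p : ℕ) : Type u := {l : List V // l ∈ K.lists ∧ l.length = p + 1}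

instance (p : ℕ) : MulAction G (K.Simplex p) where
  smul g l := ⟨l.1.map (g • ·), K.smul_mem g _ l.2.1, by simpa using l.2.2⟩
  one_smul l := Subtype.ext (by change l.1.map ((1 : G) • ·) = l.1; simp)
  mul_smul g h l := Subtype.ext (by
    change l.1.map ((g * h) • ·) = (l.1.map (h • ·)).map (g • ·)
    simp [mul_smul, Function.comp_def])

lemma smul_val {p : ℕ} (g : G) (l : K.Simplex p) : (g • l).1 = l.1.map (g • ·) := rfl

/-- No nontrivial group element fixes a nonempty list. -/
def IsFree : Prop := ∀ (g : G), ∀ l ∈ K.lists, l ≠ [] → l.map (g • ·) = l → g = 1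

variable {K} in
lemma IsFree.simplex (hK : K.IsFree) (p : ℕ) (g : G) (l : K.Simplex p) (h : g • l = l) :
    g = 1 :=
  hK g l.1 l.2.1 (by rintro h0; simpa [h0] using l.2.2) (congrArg Subtype.val h)

/-- The lists of the complex with `p` entries. -/
def level (p : ℕ) : Set (List V) := {l | l ∈ K.lists ∧ l.length = p}

/-- The inclusion of the chains of degree `p`. -/
noncomputable def incl (k : Type u) [CommRing k] (p : ℕ) : (K.Simplex p →₀ k) →ₗ[k] Chains k V :=
  Finsupp.lmapDomain k k Subtype.val

lemma incl_single {p : ℕ} (l : K.Simplex p) (r : k) :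
    K.incl k p (Finsupp.single l r) = Finsupp.single l.1 r := by
  rw [incl, Finsupp.lmapDomain_apply, Finsupp.mapDomain_single]

lemma incl_injective (p : ℕ) : Function.Injective (K.incl k p) :=
  Finsupp.mapDomain_injective Subtype.val_injective

lemma incl_mem {p : ℕ} (x : K.Simplex p →₀ k) :
    K.incl k p x ∈ Finsupp.supported k k (K.level (p + 1)) := by
  induction x using Finsupp.induction_linear with
  | zero => simp
  | add x y hx hy => rw [map_add]; exact Submodule.add_mem _ hx hy
  | single l r => rw [incl_single]; exact Chains.single_mem l.2 r

/-- The component of a chain in degree `p`. -/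
noncomputable def proj (k : Type u) [CommRing k] (p : ℕ) : Chains k V →ₗ[k] (K.Simplex p →₀ k) :=
  Finsupp.lcomapDomain Subtype.val Subtype.val_injective

lemma proj_apply {p : ℕ} (c : Chains k V) (l : K.Simplex p) : K.proj k p c l = c l.1 := rfl

lemma proj_incl {p : ℕ} (x : K.Simplex p →₀ k) : K.proj k p (K.incl k p x) = x := by
  ext l
  exact Finsupp.mapDomain_apply Subtype.val_injective x l

lemma incl_proj {p : ℕ} {c : Chains k V} (hc : c ∈ Finsupp.supported k k (K.level (p + 1))) :
    K.incl k p (K.proj k p c) = c := by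
  refine Chains.eq_of_supported (T := K.incl k p ∘ₗ K.proj k p) (T' := LinearMap.id)
    (fun l hl => ?_) hc
  have := congrArg (K.incl k p) (K.proj_incl (Finsupp.single (⟨l, hl⟩ : K.Simplex p) (1 : k)))
  rw [incl_single] at this
  exact this

lemma incl_smul {p : ℕ} (g : G) (x : K.Simplex p →₀ k) :
    K.incl k p (permRep k G _ g x) = Chains.map (g • ·) (K.incl k p x) := by
  induction x using Finsupp.induction_linear with
  | zero => simp
  | add x y hx hy => simp only [map_add, hx, hy]
  | single l r => rw [permRep_single, incl_single, incl_single, Chains.map_single, smul_val]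

/-- The representation on the chains of degree `p`. -/
noncomputable abbrev chainRep (k : Type u) [CommRing k] (p : ℕ) : Rep.{u} k G :=
  Rep.of (permRep k G (K.Simplex p))

/-- An equivariant operator on chains induces morphisms of representations. -/
noncomputable def restrictHom (F : Chains k V →ₗ[k] Chains k V)
    (hF : ∀ (g : G) c, Chains.map (g • ·) (F c) = F (Chains.map (g • ·) c)) (p q : ℕ)
    (hpq : ∀ c ∈ Finsupp.supported k k (K.level (p + 1)),
      F c ∈ Finsupp.supported k k (K.level (q + 1))) :
    K.chainRep k p ⟶ K.chainRep k q :=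
  Rep.ofHom ⟨K.proj k q ∘ₗ F ∘ₗ K.incl k p, fun g => by
    refine LinearMap.ext fun x => K.incl_injective q ?_
    simp only [LinearMap.comp_apply]
    rw [incl_smul, incl_smul, K.incl_proj (hpq _ (K.incl_mem _)), ← hF, K.incl_proj]
    rw [hF, ← incl_smul]
    exact hpq _ (K.incl_mem _)⟩

lemma incl_restrictHom {F : Chains k V →ₗ[k] Chains k V}
    {hF : ∀ (g : G) c, Chains.map (g • ·) (F c) = F (Chains.map (g • ·) c)} {p q : ℕ}
    {hpq : ∀ c ∈ Finsupp.supported k k (K.level (p + 1)),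
      F c ∈ Finsupp.supported k k (K.level (q + 1))} (x : K.Simplex p →₀ k) :
    K.incl k q ((K.restrictHom F hF p q hpq).hom x) = F (K.incl k p x) :=
  K.incl_proj (hpq _ (K.incl_mem _))

lemma chainRep_hom_ext {A : Rep.{u} k G} {p : ℕ} {f f' : A ⟶ K.chainRep k p}
    (h : ∀ x : A, K.incl k p (f.hom x) = K.incl k p (f'.hom x)) : f = f' := by
  exact Rep.hom_ext (Representation.IntertwiningMap.ext
    (LinearMap.ext fun x => K.incl_injective p (h x)))

lemma boundary_mem_level {p : ℕ} {c : Chains k V}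
    (hc : c ∈ Finsupp.supported k k (K.level (p + 1))) :
    Chains.boundary c ∈ Finsupp.supported k k (K.level p) := by
  refine Chains.map_mem_of_supported _ _ (fun l hl => ?_) hc
  rw [Chains.boundary_single]
  refine Chains.supported_mono (K' := K.level p) (fun m hm => ?_) (Chains.boundaryList_mem l)
  have h1 := hm.2
  have h2 := hl.2
  exact ⟨K.subset_mem l hl.1 m hm.1.subset, by omega⟩

/-- The boundary morphism. -/
noncomputable def d (k : Type u) [CommRing k] (p : ℕ) :
    K.chainRep k (p + 1) ⟶ K.chainRep k p :=
  K.restrictHom Chains.boundary (fun _ c => (Chains.boundary_map _ c).symm) _ _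
    fun _ hc => K.boundary_mem_level hc

lemma incl_d {p : ℕ} (x : K.Simplex (p + 1) →₀ k) :
    K.incl k p ((K.d k p).hom x) = Chains.boundary (K.incl k (p + 1) x) :=
  K.incl_restrictHom x

lemma d_comp_d (p : ℕ) : K.d k (p + 1) ≫ K.d k p = 0 := by
  refine K.chainRep_hom_ext fun x => ?_
  rw [Rep.hom_comp, Representation.IntertwiningMap.comp_apply, incl_d, incl_d,
    Chains.boundary_boundary]
  exact (map_zero _).symm

/-- The chain complex of ordered chains. -/
noncomputable def complex (k : Type u) [CommRing k] : ChainComplex (Rep.{u} k G) ℕ :=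
  ChainComplex.of (K.chainRep k) (K.d k) K.d_comp_d

lemma complex_d (p : ℕ) : (K.complex k).d (p + 1) p = K.d k p :=
  ChainComplex.of_d _ _ _

/-- The augmentation. -/
noncomputable def aug (k : Type u) [CommRing k] : K.chainRep k 0 ⟶ Rep.trivial k G k :=
  Rep.ofHom ⟨Finsupp.linearCombination k fun _ => 1, fun _ => by ext; simp⟩

lemma aug_single (l : K.Simplex 0) (r : k) : (K.aug k).hom (Finsupp.single l r) = r := by
  change Finsupp.linearCombination k _ _ = _
  simp

lemma boundary_incl_zero (x : K.Simplex 0 →₀ k) :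
    Chains.boundary (K.incl k 0 x) = Finsupp.single [] ((K.aug k).hom x) := by
  induction x using Finsupp.induction_linear with
  | zero => rw [map_zero, map_zero, map_zero, Finsupp.single_zero]
  | add x y hx hy => rw [map_add, map_add, map_add, Finsupp.single_add, hx, hy]
  | single l r =>
    rw [incl_single, aug_single]
    obtain ⟨l, h1, h2⟩ := l
    obtain ⟨a, rfl⟩ := List.length_eq_one_iff.1 h2
    rw [← Chains.cons_single, Chains.boundary_cons,
      show (Finsupp.single ([] : List V) r : Chains k V) = r • Finsupp.single [] 1 by simp,
      map_smul, Chains.boundary_nil]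
    simp

lemma d_comp_aug : K.d k 0 ≫ K.aug k = 0 := by
  refine Rep.hom_ext (Representation.IntertwiningMap.ext (LinearMap.ext fun x => ?_))
  have := K.boundary_incl_zero ((K.d k 0).hom x)
  rw [incl_d, Chains.boundary_boundary] at this
  exact (Finsupp.single_eq_zero.1 this.symm)

/-- Homogeneous cycles of an acyclic complex are boundaries of homogeneous chains. -/
lemma exists_homogeneous (hK : Chains.Acyclic k K.lists) {p : ℕ} {z : Chains k V}
    (hz : z ∈ Finsupp.supported k k (K.level p)) (hz0 : Chains.boundary z = 0) :
    ∃ y : K.Simplex p →₀ k, Chains.boundary (K.incl k p y) = z := by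
  classical
  obtain ⟨w, hw, hw'⟩ := hK z (Chains.supported_mono (fun l hl => hl.1) hz) hz0
  refine ⟨K.proj k p w, ?_⟩
  -- The part of `w` outside length `p + 1` has boundary outside length `p`, while this boundary is
  -- also a difference of chains of length `p`. It therefore vanishes.
  have h1 : w - K.incl k p (K.proj k p w) ∈
      Finsupp.supported k k {l : List V | l.length ≠ p + 1} := by
    rw [Finsupp.mem_supported']
    intro l hl
    have hl : l.length = p + 1 := by simpa using hl
    by_cases hlK : l ∈ K.lists
    · have : K.incl k p (K.proj k p w) l = K.proj k p w ⟨l, hlK, hl⟩ :=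
        Finsupp.mapDomain_apply Subtype.val_injective _ (⟨l, hlK, hl⟩ : K.Simplex p)
      rw [Finsupp.sub_apply, this, proj_apply, sub_self]
    · have h2 := (Finsupp.mem_supported' _ _).1 hw l hlK
      have h3 := (Finsupp.mem_supported' _ _).1 (K.incl_mem (K.proj k p w)) l
        fun h => hlK h.1
      rw [Finsupp.sub_apply, h2, h3, sub_self]
  have h2 : Chains.boundary (w - K.incl k p (K.proj k p w)) ∈
      Finsupp.supported k k {l : List V | l.length ≠ p} := by
    refine Chains.map_mem_of_supported _ _ (fun l hl => ?_) h1
    rw [Chains.boundary_single]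
    refine Chains.supported_mono (K' := {l : List V | l.length ≠ p}) (fun m hm hmp => hl ?_)
      (Chains.boundaryList_mem l)
    have := hm.2
    omega
  have h3 : Chains.boundary (w - K.incl k p (K.proj k p w)) ∈
      Finsupp.supported k k {l : List V | l.length = p} := by
    rw [map_sub, hw']
    exact Submodule.sub_mem _ (Chains.supported_mono (fun l hl => hl.2) hz)
      (Chains.supported_mono (fun l hl => hl.2) (K.boundary_mem_level (K.incl_mem _)))
  have h4 : Chains.boundary (w - K.incl k p (K.proj k p w)) = 0 := by
    ext l
    by_cases h : l.length = p
    · exact (Finsupp.mem_supported' _ _).1 h2 l (by simpa using h)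
    · exact (Finsupp.mem_supported' _ _).1 h3 l h
  rw [map_sub, hw', sub_eq_zero] at h4
  exact h4.symm

lemma aug_surjective (hK : Chains.Acyclic k K.lists) (hnil : [] ∈ K.lists) (r : k) :
    ∃ y, (K.aug k).hom y = r := by
  have hnil' : [] ∈ K.level 0 := ⟨hnil, rfl⟩
  obtain ⟨y, hy⟩ := K.exists_homogeneous (p := 0) (z := Finsupp.single [] r) hK
    (Chains.single_mem hnil' r) (by
      rw [show (Finsupp.single ([] : List V) r : Chains k V) = r • Finsupp.single [] 1 by simp,
        map_smul, Chains.boundary_nil, smul_zero])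
  refine ⟨y, ?_⟩
  rw [boundary_incl_zero] at hy
  exact Finsupp.single_injective _ hy

lemma exact_aug (hK : Chains.Acyclic k K.lists) (x : K.Simplex 0 →₀ k)
    (hx : (K.aug k).hom x = 0) : ∃ y, (K.d k 0).hom y = x := by
  obtain ⟨y, hy⟩ := K.exists_homogeneous (p := 1) hK (K.incl_mem x) (by
    rw [boundary_incl_zero, hx, Finsupp.single_zero])
  exact ⟨y, K.incl_injective 0 (by rw [← hy, ← incl_d])⟩

lemma exact_d (hK : Chains.Acyclic k K.lists) (n : ℕ) (x : K.Simplex (n + 1) →₀ k)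
    (hx : (K.d k n).hom x = 0) : ∃ y, (K.d k (n + 1)).hom y = x := by
  obtain ⟨y, hy⟩ := K.exists_homogeneous (p := n + 2) hK (K.incl_mem x) (by
    rw [← incl_d, hx, map_zero])
  exact ⟨y, K.incl_injective (n + 1) (by rw [← hy, ← incl_d])⟩

/-- The projective resolution given by a free acyclic complex of lists. -/
noncomputable def resolution (hfree : K.IsFree) (hK : Chains.Acyclic k K.lists)
    (hnil : [] ∈ K.lists) : ProjectiveResolution (Rep.trivial k G k) :=
  haveI : ∀ n, Projective ((K.complex k).X n) := fun n => projective_permRep (hfree.simplex n)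
  haveI : @Epi (Rep.{u} k G) _ ((K.complex k).X 0) _ (K.aug k) := (Rep.epi_iff_surjective _).2 (K.aug_surjective hK hnil)
  resolutionOfExact (K.complex k) (K.aug k)
    (by rw [complex_d]; exact K.d_comp_aug)
    ((rep_exact_iff _).2 fun x hx => by
      obtain ⟨y, hy⟩ := K.exact_aug hK x hx
      exact ⟨y, (congrArg (fun f : K.chainRep k 1 ⟶ K.chainRep k 0 => f.hom y)
        (K.complex_d 0)).trans hy⟩)
    fun n => (rep_exact_iff _).2 fun x hx => by
      obtain ⟨y, hy⟩ := K.exact_d hK n x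
        ((congrArg (fun f : K.chainRep k (n + 1) ⟶ K.chainRep k n => f.hom x)
          (K.complex_d n)).symm.trans hx)
      exact ⟨y, (congrArg (fun f : K.chainRep k (n + 2) ⟶ K.chainRep k (n + 1) => f.hom y)
        (K.complex_d (n + 1))).trans hy⟩

end ListComplex

/-! ### Alternation as a chain map, and a presentation of degree `n` cohomology. -/

namespace ListComplex

section Alternation

variable {k G V : Type u} [Field k] [CharZero k] [Group G] [MulAction G V] (K : ListComplex G V)

lemma alt_mem_level {p : ℕ} {c : Chains k V} (hc : c ∈ Finsupp.supported k k (K.level p)) :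
    Chains.alt c ∈ Finsupp.supported k k (K.level p) := by
  refine Chains.map_mem_of_supported _ _ (fun l hl => ?_) hc
  refine Chains.supported_mono (K' := K.level p) (fun m (hm : m.Perm l) => ?_)
    (Chains.alt_single_mem l)
  exact ⟨K.subset_mem l hl.1 m hm.subset, hm.length_eq.trans hl.2⟩

/-- The alternation morphism. -/
noncomputable def altHom (k : Type u) [Field k] [CharZero k] (p : ℕ) :
    K.chainRep k p ⟶ K.chainRep k p :=
  K.restrictHom Chains.alt (fun _ c => Chains.map_alt _ c) _ _ fun _ hc => K.alt_mem_level hc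

lemma incl_altHom {p : ℕ} (x : K.Simplex p →₀ k) :
    K.incl k p ((K.altHom k p).hom x) = Chains.alt (K.incl k p x) :=
  K.incl_restrictHom x

lemma altHom_comp_d (p : ℕ) : K.altHom k (p + 1) ≫ K.d k p = K.d k p ≫ K.altHom k p := by
  refine K.chainRep_hom_ext fun x => ?_
  rw [Rep.hom_comp, Representation.IntertwiningMap.comp_apply, Rep.hom_comp,
    Representation.IntertwiningMap.comp_apply, incl_d, incl_altHom, incl_altHom, incl_d,
    Chains.boundary_alt]

lemma altHom_zero : K.altHom k 0 = 𝟙 _ := by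
  refine K.chainRep_hom_ext fun x => ?_
  rw [incl_altHom]
  exact Chains.eq_of_supported (T := Chains.alt) (T' := LinearMap.id)
    (fun l hl => Chains.alt_single_of_length_le_one hl.2.le) (K.incl_mem x)

lemma altHom_eq_zero {p : ℕ} (h : ∀ l ∈ K.lists, l.length = p + 1 → ¬ l.Nodup) :
    K.altHom k p = 0 := by
  refine K.chainRep_hom_ext fun x => ?_
  rw [incl_altHom]
  exact (Chains.eq_of_supported (T := Chains.alt) (T' := 0)
    (fun l hl => Chains.alt_single_of_not_nodup (h l hl.1 hl.2)) (K.incl_mem x)).trans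
    (K.incl k p).map_zero.symm

/-- The alternation chain map. -/
noncomputable def altMap (k : Type u) [Field k] [CharZero k] : K.complex k ⟶ K.complex k :=
  ChainComplex.ofHom (K.altHom k) fun p => by
    rw [complex_d]
    exact K.altHom_comp_d p

end Alternation

section Presentation

variable {k G V W : Type u} [Field k] [CharZero k] [Group G] [MulAction G V] [MulAction G W]

/-- If `G` has an acyclic free complex without nondegenerate simplices of dimension `n + 1`, then
the cohomology of degree `n` is computed by a complex `Hom(C', A) → {f ∈ Hom(C, A) | f e = f}` for
a projector `e` of the ordered chains `C` of degree `n` of any acyclic free complex. -/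
theorem exists_presentation (K : ListComplex G V) (hfree : K.IsFree)
    (hK : Chains.Acyclic k K.lists) (hnil : [] ∈ K.lists)
    (L : ListComplex G W) (hfree' : L.IsFree) (hL : Chains.Acyclic k L.lists)
    (hnil' : [] ∈ L.lists) (n : ℕ) (hdim : ∀ l ∈ L.lists, l.length = n + 2 → ¬ l.Nodup) :
    ∃ (d : K.chainRep k n ⟶ K.chainRep k ((ComplexShape.up ℕ).prev n))
      (e : K.chainRep k n ⟶ K.chainRep k n), e ≫ d = d ∧ e ≫ e = e ∧
      ∀ A : Rep.{u} k G, Subsingleton (groupCohomology A n) ↔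
        ∀ f : K.chainRep k n ⟶ A, e ≫ f = f →
          ∃ g : K.chainRep k ((ComplexShape.up ℕ).prev n) ⟶ A, d ≫ g = f := by
  let P := K.resolution hfree hK hnil
  let Q := L.resolution hfree' hL hnil'
  let a : Q.complex ⟶ Q.complex := L.altMap k
  have ha0 : a.f 0 = 𝟙 _ := L.altHom_zero
  have ha : a ≫ Q.π = Q.π := by
    refine HomologicalComplex.to_single_hom_ext ?_
    rw [HomologicalComplex.comp_f, ha0, Category.id_comp]
  have hn : a.f (n + 1) = 0 := L.altHom_eq_zero hdim
  obtain ⟨e, he, key⟩ := exists_projector P Q a ha n hn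
  -- For `n = 0` the conventional predecessor is `0` and this differential is zero, so the criterion
  -- still describes degree zero cohomology.
  refine ⟨P.complex.d n _, e, (key _).2 (P.complex.d_comp_d _ _ _), he, fun A => ?_⟩
  rw [subsingleton_groupCohomology_iff P]
  exact forall_congr' fun f => imp_congr_left (key f).symm

end Presentation

end ListComplex

/-! ### Stability of surjectivity. -/

section Surjective

variable {𝕜 E F : Type*} [NontriviallyNormedField 𝕜] [NormedAddCommGroup E] [NormedSpace 𝕜 E]
  [NormedAddCommGroup F] [NormedSpace 𝕜 F] [CompleteSpace E] [CompleteSpace F]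

/-- Surjectivity is an open condition on operators between Banach spaces. -/
lemma eventually_surjective {T : E →L[𝕜] F} (hT : Function.Surjective T) :
    ∀ᶠ T' : E →L[𝕜] F in 𝓝 T, Function.Surjective T' := by
  let s := T.nonlinearRightInverseOfSurjective (LinearMap.range_eq_top.2 hT)
  rcases subsingleton_or_nontrivial F with h | h
  · exact Eventually.of_forall fun T' y => ⟨0, Subsingleton.elim _ _⟩
  have hs : 0 < s.nnnorm := T.nonlinearRightInverseOfSurjective_nnnorm_pos _
  have h2 : 0 < s.nnnorm⁻¹ / 2 := by positivity
  filter_upwards [Metric.ball_mem_nhds T (NNReal.coe_pos.2 h2)] with T' hT'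
  have happ : ApproximatesLinearOn T' T Set.univ (s.nnnorm⁻¹ / 2) := by
    intro x _ y _
    have : T' x - T' y - T (x - y) = (T' - T) (x - y) := by simp
    rw [this]
    refine ((T' - T).le_opNorm _).trans ?_
    gcongr
    rw [← dist_eq_norm]
    exact (Metric.mem_ball.1 hT').le
  intro y
  have hpos : 0 < (s.nnnorm : ℝ)⁻¹ - ((s.nnnorm⁻¹ / 2 : NNReal) : ℝ) := by
    push_cast
    have : 0 < (s.nnnorm : ℝ)⁻¹ := inv_pos.2 (NNReal.coe_pos.2 hs)
    linarith
  -- The radius is chosen so that the guaranteed image ball around `0` has radius exactly `‖y‖`.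
  obtain ⟨x, -, hx⟩ := happ.surjOn_closedBall_of_nonlinearRightInverse s
    (ε := ‖y‖ / ((s.nnnorm : ℝ)⁻¹ - ((s.nnnorm⁻¹ / 2 : NNReal) : ℝ))) (b := 0)
    (by positivity) (Set.subset_univ _)
    (show y ∈ _ by rw [mul_div_cancel₀ _ hpos.ne', map_zero, mem_closedBall_zero_iff])
  exact ⟨x, hx⟩

end Surjective

/-! ### Cochain operators as continuous functions of the representation. -/

section Deformation

variable {𝕜 Γ E : Type u} [RCLike 𝕜] [Group Γ] [NormedAddCommGroup E] [NormedSpace 𝕜 E]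

/-- The filter of neighbourhoods of a representation for the topology of convergence in norm
on `S`. -/
def nearby (S : Set Γ) (π : Γ →* (E →L[𝕜] E)) : Filter (Γ →* (E →L[𝕜] E)) :=
  comap (fun ρ (s : S) => ρ s) (𝓝 fun s : S => π s)

/-- Every group element is a word in `S` and inverses; multiplication is continuous, and so is
inversion at a unit of the Banach algebra of operators. -/
lemma tendsto_nearby [CompleteSpace E] {S : Set Γ} (hS : Subgroup.closure S = ⊤)
    (π : Γ →* (E →L[𝕜] E)) (γ : Γ) :
    Tendsto (fun ρ : Γ →* (E →L[𝕜] E) => ρ γ) (nearby S π) (𝓝 (π γ)) := by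
  have hγ : γ ∈ Subgroup.closure S := by rw [hS]; trivial
  induction hγ using Subgroup.closure_induction with
  | mem s hs => exact (tendsto_pi_nhds.1 (tendsto_comap (f := fun (ρ : Γ →* (E →L[𝕜] E)) (s : S) => ρ s))) ⟨s, hs⟩
  | one => simpa using tendsto_const_nhds
  | mul a b _ _ ha hb => simpa using ha.mul hb
  | inv a _ ha =>
    have h1 : ∀ ρ : Γ →* (E →L[𝕜] E), ρ a⁻¹ = Ring.inverse (ρ a) := fun ρ => by
      have : ρ a = (ρ.toHomUnits a : E →L[𝕜] E) := rfl
      rw [this, Ring.inverse_unit, ← map_inv]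
      rfl
    simp only [h1]
    exact (NormedRing.inverse_continuousAt (π.toHomUnits a)).tendsto.comp ha

lemma exists_deformation_of_eventually {S : Set Γ} (hS : S.Finite) {π : Γ →* (E →L[𝕜] E)}
    {p : (Γ →* (E →L[𝕜] E)) → Prop} (h : ∀ᶠ ρ in nearby S π, p ρ) :
    ∃ ε : ℝ, 0 < ε ∧ ∀ ρ, IsDeformation S ε π ρ → p ρ := by
  have := hS.fintype
  obtain ⟨δ, hδ, hsub⟩ := (Metric.nhds_basis_ball.comap _).eventually_iff.1 h
  -- Halving turns the nonstrict bound of a deformation into the strict bound of a ball.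
  refine ⟨δ / 2, half_pos hδ, fun ρ hρ => hsub ?_⟩
  rw [Set.mem_preimage, Metric.mem_ball, dist_pi_lt_iff hδ]
  intro s
  rw [dist_comm, dist_eq_norm]
  exact (hρ s s.2).trans_lt (half_lt_self hδ)

/-- The `Γ`-module of a representation by bounded operators. -/
noncomputable abbrev boundedRep (ρ : Γ →* (E →L[𝕜] E)) : Rep.{u} 𝕜 Γ :=
  Rep.of ((ContinuousLinearMap.toLinearMapRingHom (R₁ := 𝕜) (M₁ := E)).toMonoidHom.comp ρ)

variable {T T' : Type u} [MulAction Γ T] [MulAction Γ T']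
  [Fintype (MulAction.orbitRel.Quotient Γ T)]

open Classical in
/-- Precomposition with a morphism of free permutation modules, as a bounded operator in the
coordinates given by the representatives of the orbits. -/
noncomputable def pullback (φ : Rep.of (permRep 𝕜 Γ T) ⟶ Rep.of (permRep 𝕜 Γ T'))
    (ρ : Γ →* (E →L[𝕜] E)) :
    (MulAction.orbitRel.Quotient Γ T' → E) →L[𝕜] (MulAction.orbitRel.Quotient Γ T → E) :=
  ∑ ω, ∑ t ∈ (φ.hom (Finsupp.single (orbitOut Γ ω) 1) : T' →₀ 𝕜).support,
    (φ.hom (Finsupp.single (orbitOut Γ ω) 1) : T' →₀ 𝕜) t •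
      (ContinuousLinearMap.single 𝕜 (fun _ => E) ω ∘L ρ (orbitCoord Γ t) ∘L
        ContinuousLinearMap.proj (orbitOf Γ t))

/-- In orbit coordinates the operator is a finite sum with fixed coefficients, involving `ρ` at only
finitely many group elements. -/
lemma tendsto_pullback [Fintype (MulAction.orbitRel.Quotient Γ T')] [CompleteSpace E] {S : Set Γ} (hS : Subgroup.closure S = ⊤)
    (φ : Rep.of (permRep 𝕜 Γ T) ⟶ Rep.of (permRep 𝕜 Γ T')) (π : Γ →* (E →L[𝕜] E)) :
    Tendsto (pullback φ) (nearby S π) (𝓝 (pullback φ π)) := by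
  refine tendsto_finsetSum _ fun ω _ => tendsto_finsetSum _ fun t _ => Tendsto.const_smul ?_ _
  exact ((continuous_const.clm_comp (continuous_id.clm_comp continuous_const)).tendsto _).comp
    (tendsto_nearby hS π _)

lemma pullback_apply (hT' : ∀ (g : Γ) (t : T'), g • t = t → g = 1)
    (φ : Rep.of (permRep 𝕜 Γ T) ⟶ Rep.of (permRep 𝕜 Γ T')) (ρ : Γ →* (E →L[𝕜] E))
    (a : MulAction.orbitRel.Quotient Γ T' → E) (ω : MulAction.orbitRel.Quotient Γ T) :
    pullback φ ρ a ω =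
      (φ ≫ freeHom hT' (boundedRep ρ) a).hom (Finsupp.single (orbitOut Γ ω) 1) := by
  classical
  have h1 : (φ ≫ freeHom hT' (boundedRep ρ) a).hom (Finsupp.single (orbitOut Γ ω) 1) =
      Finsupp.linearCombination 𝕜 (fun t => ρ (orbitCoord Γ t) (a (orbitOf Γ t)))
        (φ.hom (Finsupp.single (orbitOut Γ ω) 1) : T' →₀ 𝕜) := rfl
  rw [h1, Finsupp.linearCombination_apply, Finsupp.sum, pullback]
  simp only [sum_apply, Finset.sum_apply]
  rw [Finset.sum_eq_single ω]
  · simp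
  · intro ω' _ hne
    refine Finset.sum_eq_zero fun t _ => ?_
    simp [Pi.single_eq_of_ne hne.symm]
  · simp

lemma freeHom_pullback (hT : ∀ (g : Γ) (t : T), g • t = t → g = 1)
    (hT' : ∀ (g : Γ) (t : T'), g • t = t → g = 1)
    (φ : Rep.of (permRep 𝕜 Γ T) ⟶ Rep.of (permRep 𝕜 Γ T')) (ρ : Γ →* (E →L[𝕜] E))
    (a : MulAction.orbitRel.Quotient Γ T' → E) :
    freeHom hT (boundedRep ρ) (pullback φ ρ a) = φ ≫ freeHom hT' (boundedRep ρ) a := by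
  refine perm_hom_ext fun t => ?_
  rw [freeHom_single, hom_single_eq, pullback_apply hT' φ ρ a]

/-- The operator whose surjectivity expresses the vanishing of the cohomology. -/
noncomputable def testOperator (d : Rep.of (permRep 𝕜 Γ T) ⟶ Rep.of (permRep 𝕜 Γ T'))
    (e : Rep.of (permRep 𝕜 Γ T) ⟶ Rep.of (permRep 𝕜 Γ T)) (ρ : Γ →* (E →L[𝕜] E)) :
    ((MulAction.orbitRel.Quotient Γ T' → E) × (MulAction.orbitRel.Quotient Γ T → E)) →L[𝕜]
      (MulAction.orbitRel.Quotient Γ T → E) :=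
  pullback d ρ ∘L ContinuousLinearMap.fst 𝕜 _ _ +
    (ContinuousLinearMap.id 𝕜 _ - pullback e ρ) ∘L ContinuousLinearMap.snd 𝕜 _ _

lemma testOperator_surjective_iff (hT : ∀ (g : Γ) (t : T), g • t = t → g = 1)
    (hT' : ∀ (g : Γ) (t : T'), g • t = t → g = 1)
    {d : Rep.of (permRep 𝕜 Γ T) ⟶ Rep.of (permRep 𝕜 Γ T')}
    {e : Rep.of (permRep 𝕜 Γ T) ⟶ Rep.of (permRep 𝕜 Γ T)} (hd : e ≫ d = d) (he : e ≫ e = e)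
    (ρ : Γ →* (E →L[𝕜] E)) :
    Function.Surjective (testOperator d e ρ) ↔
      ∀ f : Rep.of (permRep 𝕜 Γ T) ⟶ boundedRep ρ, e ≫ f = f →
        ∃ g : Rep.of (permRep 𝕜 Γ T') ⟶ boundedRep ρ, d ≫ g = f := by
  have hee : ∀ a : MulAction.orbitRel.Quotient Γ T → E,
      pullback e ρ (pullback e ρ a) = pullback e ρ a := fun a =>
    freeHom_injective hT (boundedRep ρ) (by
      rw [freeHom_pullback hT hT, freeHom_pullback hT hT, ← Category.assoc, he])
  have hed : ∀ a : MulAction.orbitRel.Quotient Γ T' → E,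
      pullback e ρ (pullback d ρ a) = pullback d ρ a := fun a =>
    freeHom_injective hT (boundedRep ρ) (by
      rw [freeHom_pullback hT hT, freeHom_pullback hT hT', ← Category.assoc, hd])
  constructor
  · intro h f hf
    obtain ⟨a, rfl⟩ := freeHom_surjective hT _ f
    obtain ⟨⟨b, c⟩, hbc⟩ := h a
    refine ⟨freeHom hT' _ b, ?_⟩
    rw [← freeHom_pullback hT hT']
    have ha : pullback e ρ a = a :=
      freeHom_injective hT (boundedRep ρ) ((freeHom_pullback hT hT e ρ a).trans hf)
    -- Applying `e^*` fixes `d^* b` and kills `(1 - e^*) c`, so a fixed `a` in the image is already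
    -- `d^* b`.
    have : pullback e ρ (testOperator d e ρ (b, c)) = pullback d ρ b := by
      simp [testOperator, hee, hed]
    rw [← this, hbc, ha]
  · intro h a
    obtain ⟨g, hg⟩ := h (freeHom hT _ (pullback e ρ a)) (by
      rw [← freeHom_pullback hT hT e ρ, hee])
    obtain ⟨b, rfl⟩ := freeHom_surjective hT' _ g
    -- Decompose `a = e^* a + (1 - e^*) a` and use `d^* b = e^* a`.
    refine ⟨(b, a), ?_⟩
    have : pullback d ρ b = pullback e ρ a :=
      freeHom_injective hT (boundedRep ρ) ((freeHom_pullback hT hT' d ρ b).trans hg)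
    simp [testOperator, this]

lemma tendsto_testOperator [Fintype (MulAction.orbitRel.Quotient Γ T')] [CompleteSpace E] {S : Set Γ} (hS : Subgroup.closure S = ⊤)
    (d : Rep.of (permRep 𝕜 Γ T) ⟶ Rep.of (permRep 𝕜 Γ T'))
    (e : Rep.of (permRep 𝕜 Γ T) ⟶ Rep.of (permRep 𝕜 Γ T)) (π : Γ →* (E →L[𝕜] E)) :
    Tendsto (testOperator d e) (nearby S π) (𝓝 (testOperator d e π)) :=
  (((continuous_id.clm_comp continuous_const).tendsto _).comp (tendsto_pullback hS d π)).add
    ((((continuous_const.sub continuous_id).clm_comp continuous_const).tendsto _).comp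
      (tendsto_pullback hS e π))

end Deformation

/-! ### The action on lists in faces. -/

section Faces

variable {Γ : Type u} [Group Γ] {V : Type v} [MulAction Γ V] {X : AbstractSimplicialComplex V}

lemma mem_translate {g : Γ} {σ : Finset V} {a : V} : a ∈ translate g σ ↔ ∃ b ∈ σ, g • b = a :=
  Finset.mem_map

lemma IsEilenbergMacLane.smul_mem (hX : IsEilenbergMacLane Γ X) (g : Γ) {l : List V}
    (hl : l ∈ faceLists X) : l.map (g • ·) ∈ faceLists X := by
  obtain ⟨σ, hσ, h⟩ := hl
  refine ⟨translate g σ, hX.translate_mem g σ hσ, fun a ha => ?_⟩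
  obtain ⟨b, hb, rfl⟩ := List.mem_map.1 ha
  exact mem_translate.2 ⟨b, h b hb, rfl⟩

lemma IsEilenbergMacLane.eq_one (hX : IsEilenbergMacLane Γ X) (g : Γ) {l : List V}
    (hl : l ∈ faceLists X) (hne : l ≠ []) (h : l.map (g • ·) = l) : g = 1 := by
  classical
  refine hX.free g _ (toFinset_mem_faces hl hne) ?_
  ext a
  rw [mem_translate]
  conv_rhs => rw [← h]
  simp

lemma IsEilenbergMacLane.nonempty (hX : IsEilenbergMacLane Γ X) : Nonempty V := by
  have := hX.contractible
  exact ⟨peak (Classical.arbitrary (Realization X))⟩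

lemma nil_mem_faceLists [Nonempty V] : [] ∈ faceLists X :=
  ⟨_, X.singleton_mem (Classical.arbitrary V), by simp⟩

end Faces

/-! ### Eilenberg-MacLane spaces as complexes of lists, with a change of vertex universe. -/

section Transfer

/-- The pull-back of the lists in the faces of a complex along a bijection of the vertices. -/
def IsEilenbergMacLane.listComplex {Γ W : Type u} [Group Γ] {V : Type v} [MulAction Γ V]
    [MulAction Γ W] {X : AbstractSimplicialComplex V} (hX : IsEilenbergMacLane Γ X) (e : W ≃ V)
    (he : ∀ (g : Γ) (w : W), e (g • w) = g • e w) : ListComplex Γ W where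
  lists := {l | l.map e ∈ faceLists X}
  subset_mem _ hl _ hm := faceLists_of_subset hl (List.map_subset e hm)
  smul_mem g l hl := by
    have := hX.smul_mem g hl
    simpa [Function.comp_def, he] using this

variable {Γ W : Type u} [Group Γ] {V : Type v} [MulAction Γ V]
    [MulAction Γ W] {X : AbstractSimplicialComplex V} (hX : IsEilenbergMacLane Γ X) (e : W ≃ V)
    (he : ∀ (g : Γ) (w : W), e (g • w) = g • e w)

include hX in
lemma IsEilenbergMacLane.isFree_listComplex : (hX.listComplex e he).IsFree := by
  intro g l hl hne h
  refine hX.eq_one g hl (by simpa using hne) ?_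
  conv_rhs => rw [← h]
  simp [Function.comp_def, he]

lemma IsEilenbergMacLane.nil_mem_listComplex : [] ∈ (hX.listComplex e he).lists := by
  have := hX.nonempty
  exact nil_mem_faceLists

lemma IsEilenbergMacLane.acyclic_listComplex (k : Type u) [CommRing k] :
    Chains.Acyclic k (hX.listComplex e he).lists := by
  intro z hz hz0
  have := hX.contractible
  obtain ⟨w, hw, hw'⟩ := acyclic_faceLists (X := X) k (Chains.map e z)
    (Chains.map_mem (fun l hl => hl) hz) (by rw [Chains.boundary_map, hz0, map_zero])
  refine ⟨Chains.map e.symm w, Chains.map_mem (fun l hl => ?_) hw, ?_⟩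
  · simpa [IsEilenbergMacLane.listComplex] using hl
  · have hid : (Chains.map id : Chains k W →ₗ[k] _) = LinearMap.id :=
      Chains.hom_ext fun l => by simp
    rw [Chains.boundary_map, hw', Chains.map_map, e.symm_comp_self, hid, LinearMap.id_apply]

lemma IsEilenbergMacLane.not_nodup {n : ℕ} (hdim : DimLE X n) {l : List W}
    (hl : l ∈ (hX.listComplex e he).lists) (hlen : l.length = n + 2) : ¬ l.Nodup := by
  classical
  intro hnd
  have hface := toFinset_mem_faces (l := l.map e) hl (by
    rintro h
    have := congrArg List.length h
    simp [hlen] at this)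
  have h1 := hdim _ hface
  rw [List.toFinset_card_of_nodup (hnd.map e.injective), List.length_map, hlen] at h1
  omega

lemma finite_lists {α : Type*} {F : Set α} (hF : F.Finite) (n : ℕ) :
    {l : List α | l.length = n ∧ ∀ a ∈ l, a ∈ F}.Finite := by
  have := hF.to_subtype
  refine ((List.finite_length_eq F n).image (List.map Subtype.val)).subset ?_
  rintro l ⟨hl, h⟩
  exact ⟨l.attach.map fun a => ⟨a.1, h a.1 a.2⟩, by simpa using hl, by
    simp [Function.comp_def]⟩

lemma IsEilenbergMacLane.finite_orbits {n : ℕ} (hfin : HasFiniteSkeletonMod Γ X n) {p : ℕ}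
    (hp : p ≤ n) :
    Finite (MulAction.orbitRel.Quotient Γ ((hX.listComplex e he).Simplex p)) := by
  classical
  obtain ⟨T, hT, hcov⟩ := hfin
  -- The finite set of vertices of the simplex representatives: every list of length `p + 1` can be
  -- translated to have its entries in `F`.
  let F : Set W := ⋃ τ ∈ T, e ⁻¹' (τ : Set V)
  have hF : F.Finite := hT.biUnion fun τ _ => τ.finite_toSet.preimage e.injective.injOn
  let A : Set ((hX.listComplex e he).Simplex p) := Subtype.val ⁻¹'
    {l : List W | l.length = p + 1 ∧ ∀ a ∈ l, a ∈ F}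
  have hA : A.Finite := (finite_lists hF (p + 1)).preimage Subtype.val_injective.injOn
  have := hA.to_subtype
  refine Finite.of_surjective (fun a : A => orbitOf Γ a.1) fun ω => ?_
  obtain ⟨l, rfl⟩ : ∃ l, orbitOf Γ l = ω := ⟨orbitOut Γ ω, orbitOf_orbitOut ω⟩
  have hface := toFinset_mem_faces (l := l.1.map e) l.2.1 (by
    intro h
    have := congrArg List.length h
    simp [l.2.2] at this)
  have hcard : (l.1.map e).toFinset.card ≤ n + 1 := by
    refine (List.toFinset_card_le _).trans ?_
    rw [List.length_map, l.2.2]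
    omega
  obtain ⟨τ, hτ, g, hg⟩ := hcov _ hface hcard
  refine ⟨⟨g⁻¹ • l, (g⁻¹ • l).2.2, fun a ha => ?_⟩, orbitOf_smul _ _⟩
  rw [ListComplex.smul_val] at ha
  obtain ⟨b, hb, rfl⟩ := List.mem_map.1 ha
  have h1 : e b ∈ translate g τ := by
    rw [hg]
    exact List.mem_toFinset.2 (List.mem_map_of_mem hb)
  obtain ⟨c, hc, hgc⟩ := mem_translate.1 h1
  refine Set.mem_biUnion hτ ?_
  change e (g⁻¹ • b) ∈ τ
  rw [he, ← hgc, inv_smul_smul]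
  exact hc

-- Every vertex is a translate of one of finitely many, so `V` is an image of `Fin m × Γ`. This lets
-- the vertices be moved to the universe of `Γ`, where its representations live.
omit [MulAction Γ W] in
lemma small_of_hasFiniteSkeletonMod [Nonempty V] {n : ℕ} (hfin : HasFiniteSkeletonMod Γ X n) :
    Small.{u} V := by
  classical
  obtain ⟨T, hT, hcov⟩ := hfin
  have := hT.to_subtype
  obtain ⟨m, ⟨i⟩⟩ := Finite.exists_equiv_fin T
  refine small_of_surjective.{u} (α := Fin m × Γ) (f := fun p =>
    if h : (i.symm p.1).1.Nonempty then p.2 • h.choose else Classical.arbitrary V) fun a => ?_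
  obtain ⟨τ, hτ, g, hg⟩ := hcov {a} (X.singleton_mem a) (by simp)
  have hne : τ.Nonempty := by
    obtain ⟨b, hb, -⟩ := mem_translate.1 (hg ▸ Finset.mem_singleton_self a)
    exact ⟨b, hb⟩
  refine ⟨(i ⟨τ, hτ⟩, g), ?_⟩
  have : g • hne.choose ∈ translate g τ := mem_translate.2 ⟨_, hne.choose_spec, rfl⟩
  rw [hg, Finset.mem_singleton] at this
  simpa [hne] using this

end Transfer

end BanachCohomology

/-! ### The stability theorem. -/

open BanachCohomology in
theorem mainTheorem6 {𝕜 Γ : Type u} [RCLike 𝕜] [Group Γ] (n : ℕ)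
    (hdim : BanachCohomology.HasGeometricDimension Γ n)
    {V : Type v} [MulAction Γ V] (X : AbstractSimplicialComplex V)
    (hX : BanachCohomology.IsEilenbergMacLane Γ X)
    (hfin : BanachCohomology.HasFiniteSkeletonMod Γ X n)
    (S : Set Γ) (hS : S.Finite) (hgen : Subgroup.closure S = ⊤)
    {E : Type u} [NormedAddCommGroup E] [NormedSpace 𝕜 E] [CompleteSpace E]
    (π : Γ →* (E →L[𝕜] E))
    (hπ : Subsingleton (BanachCohomology.cohomology n π)) :
    ∃ ε : ℝ, 0 < ε ∧ ∀ ρ : Γ →* (E →L[𝕜] E),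
      BanachCohomology.IsDeformation S ε π ρ →
        Subsingleton (BanachCohomology.cohomology n ρ) := by
  obtain ⟨⟨W, _, Y, hY, hYdim⟩, -⟩ := hdim
  have := hX.nonempty
  have := small_of_hasFiniteSkeletonMod hfin
  let e : Shrink.{u} V ≃ V := (equivShrink V).symm
  let _ : MulAction Γ (Shrink.{u} V) := e.mulAction Γ
  have he : ∀ (g : Γ) (w : Shrink.{u} V), e (g • w) = g • e w := fun g w =>
    e.apply_symm_apply _
  obtain ⟨d, p, hd, hp, hcoh⟩ := ListComplex.exists_presentation (k := 𝕜) (hX.listComplex e he)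
    (hX.isFree_listComplex e he) (hX.acyclic_listComplex e he 𝕜) (hX.nil_mem_listComplex e he)
    (hY.listComplex (Equiv.refl W) fun _ _ => rfl) (hY.isFree_listComplex _ _)
    (hY.acyclic_listComplex _ _ 𝕜) (hY.nil_mem_listComplex _ _) n
    (fun l hl hlen => hY.not_nodup _ _ hYdim hl hlen)
  -- Both cochain degrees involved are at most `n`, so finiteness of the `n`-skeleton modulo `Γ`
  -- suffices.
  have hprev : (ComplexShape.up ℕ).prev n ≤ n := by
    cases n with
    | zero => rw [CochainComplex.prev_nat_zero]
    | succ n => rw [CochainComplex.prev_nat_succ]; omega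
  have := hX.finite_orbits e he hfin le_rfl
  have := hX.finite_orbits e he hfin hprev
  have := Fintype.ofFinite (MulAction.orbitRel.Quotient Γ ((hX.listComplex e he).Simplex n))
  have := Fintype.ofFinite (MulAction.orbitRel.Quotient Γ
    ((hX.listComplex e he).Simplex ((ComplexShape.up ℕ).prev n)))
  have hiff : ∀ ρ : Γ →* (E →L[𝕜] E), Subsingleton (cohomology n ρ) ↔
      Function.Surjective (testOperator d p ρ) := fun ρ =>
    (hcoh (boundedRep ρ)).trans (testOperator_surjective_iff
      ((hX.isFree_listComplex e he).simplex _) ((hX.isFree_listComplex e he).simplex _)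
      hd hp ρ).symm
  simp only [hiff] at hπ ⊢
  exact exists_deformation_of_eventually hS
    ((tendsto_testOperator hgen d p π).eventually (eventually_surjective hπ))
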